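/- **Setting.** A base station with $N\ge 1$ antennas serves $K$ single-antenna users over a block-fading channel with coherence time $T\ge 1$ and noise level $N_0>0$; let $P_0>0$. A fraction $\alpha\in(0,1)$ of each frame, with $\alpha T$ an integer, is used for training. With a pilot matrix $X_p\in\mathbb{C}^{K\times\alpha T}$ (its $k$-th row $x_{p,k}^{T}$ is the pilot of user $k$) the base station receives $Y_p=HDX_p+W_p$, where $D=\mathrm{diag}\{d_1,\dots,d_K\}$, $H\in\mathbb{C}^{N\times K}$ has i.i.d. $\mathcal{CN}(0,1)$ entries, and $W_p\in\mathbb{C}^{N\times\alpha T}$ is independent of $H$ with i.i.d. $\mathcal{CN}(0,N_0)$ entries. Put $$\widehat H=Y_p\,(X_p^\dagger D^2X_p+N_0I_{\alpha T})^{-1}X_p^\dagger D,\qquad M_{\widehat H}=I_K-DX_p\,(X_p^\dagger D^2X_p+N_0I_{\alpha T})^{-1}X_p^\dagger D,$$ $$R_{X_d}=\mathrm{diag}\{\gamma_1'P_0,\dots,\gamma_K'P_0\},\qquad \sigma_v^2=\mathrm{tr}(M_{\widehat H}D^2R_{X_d})+N_0 .$$ The throughput is $$R(X_p)=(1-\alpha)\,\mathbb{E}\Big[\log_2\det\Big(I_N+\tfrac{1}{\sigma_v^2}\widehat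 H D R_{X_d}D\widehat H^\dagger\Big)\Big].$$ For given training and data power coefficients $\gamma_k,\gamma'_k$, a pilot matrix is called *optimal* if it maximizes $R(X_p)$ among all $X_p\in\mathbb{C}^{K\times\alpha T}$ such that, for every $k$, the $k$-th diagonal entry of $X_pX_p^\dagger$ is $\alpha\gamma_kP_0T$. **Theorem (optimal pilots under uniform large-scale fading).** Assume $d_k=d>0$, $\gamma_k=\gamma\ge 0$ and $\gamma'_k=\gamma'>0$ for all $k$. Then the expectation defining $R(X_p)$ is finite for every $X_p$, an optimal pilot matrix exists, and the following hold. 1. If $K\le\alpha T$, then $X_p$ is optimal if and only if $X_pX_p^\dagger=\alpha\gamma P_0T\,I_K$. 2. If $K>\alpha T$, then $X_p$ is optimal if and only if $X_p^\dagger X_p=\gamma P_0K\,I_{\alpha T}$ and $\|x_{p,k}\|^2=\alpha\gamma P_0T$ for every $k$. If moreover $\gamma>0$, the pilots of an optimal $X_p$ are not mutually orthogonal: $\langle x_{p,i},x_{p,j}\rangle\ne 0$ for some $i\neq j$. -/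

import Mathlib

open MeasureTheory ProbabilityTheory
open scoped Matrix

namespace MIMO

noncomputable section

/-- The law `CN(0, v)`: real and imaginary parts are independent `N(0, v/2)`, so `E|z|² = v`. -/
def complexGaussian (v : ℝ) : Measure ℂ :=
  ((gaussianReal 0 (v / 2).toNNReal).prod (gaussianReal 0 (v / 2).toNNReal)).map
    (fun p : ℝ × ℝ => (⟨p.1, p.2⟩ : ℂ))

/-- The law of an `m × n` matrix with independent `CN(0, v)` entries. -/
def gaussianMatrixLaw (m n : ℕ) (v : ℝ) : Measure (Fin m → Fin n → ℂ) :=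
  Measure.pi fun _ => Measure.pi fun _ => complexGaussian v

/-- The diagonal matrix `D = diag{d₁, …, d_K}` of large-scale fading coefficients. -/
def fadingMatrix {K : ℕ} (d : Fin K → ℝ) : Matrix (Fin K) (Fin K) ℂ :=
  Matrix.diagonal fun k => (d k : ℂ)

/-- The data covariance matrix `R_{X_d} = diag{γ'₁ P₀, …, γ'_K P₀}`. -/
def dataCovariance {K : ℕ} (P₀ : ℝ) (γ' : Fin K → ℝ) : Matrix (Fin K) (Fin K) ℂ :=
  Matrix.diagonal fun k => ((γ' k * P₀ : ℝ) : ℂ)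

/-- The matrix `R_X = diag{α γ₁ P₀ T, …, α γ_K P₀ T}` of training energies. -/
def trainingEnergy {K : ℕ} (α P₀ : ℝ) (T : ℕ) (γ : Fin K → ℝ) : Matrix (Fin K) (Fin K) ℂ :=
  Matrix.diagonal fun k => ((α * γ k * P₀ * T : ℝ) : ℂ)

/-- The signal received in the training phase, `Y_p = H D X_p + W_p`. -/
def receivedPilots {N K M : ℕ} (d : Fin K → ℝ) (X : Matrix (Fin K) (Fin M) ℂ)
    (H : Matrix (Fin N) (Fin K) ℂ) (W : Matrix (Fin N) (Fin M) ℂ) :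
    Matrix (Fin N) (Fin M) ℂ :=
  H * fadingMatrix d * X + W

/-- The covariance matrix `X_p† D² X_p + N₀ I` of the rows of `Y_p`. -/
def pilotCovariance {K M : ℕ} (N₀ : ℝ) (d : Fin K → ℝ) (X : Matrix (Fin K) (Fin M) ℂ) :
    Matrix (Fin M) (Fin M) ℂ :=
  Xᴴ * fadingMatrix d ^ 2 * X + (N₀ : ℂ) • (1 : Matrix (Fin M) (Fin M) ℂ)

/-- The MMSE channel estimate `Ĥ = Y_p (X_p† D² X_p + N₀ I)⁻¹ X_p† D`. -/
def channelEstimate {N K M : ℕ} (N₀ : ℝ) (d : Fin K → ℝ) (X : Matrix (Fin K) (Fin M) ℂ)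
    (Y : Matrix (Fin N) (Fin M) ℂ) : Matrix (Fin N) (Fin K) ℂ :=
  Y * (pilotCovariance N₀ d X)⁻¹ * Xᴴ * fadingMatrix d

/-- The error covariance `M_Ĥ = I - D X_p (X_p† D² X_p + N₀ I)⁻¹ X_p† D` of the estimate. -/
def mmseMatrix {K M : ℕ} (N₀ : ℝ) (d : Fin K → ℝ) (X : Matrix (Fin K) (Fin M) ℂ) :
    Matrix (Fin K) (Fin K) ℂ :=
  1 - fadingMatrix d * X * (pilotCovariance N₀ d X)⁻¹ * Xᴴ * fadingMatrix d

/-- The equivalent noise power `σ_v² = tr(M_Ĥ D² R_{X_d}) + N₀` (the trace is real). -/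
def noisePower {K M : ℕ} (P₀ N₀ : ℝ) (d γ' : Fin K → ℝ) (X : Matrix (Fin K) (Fin M) ℂ) : ℝ :=
  (Matrix.trace (mmseMatrix N₀ d X * fadingMatrix d ^ 2 * dataCovariance P₀ γ')).re + N₀

/-- The instantaneous rate `log₂ |I_N + σ_v⁻² Ĥ D R_{X_d} D Ĥ†|` for the channel realization `H`
and the training noise `W` (the determinant is real). -/
def instantRate {N K M : ℕ} (P₀ N₀ : ℝ) (d γ' : Fin K → ℝ) (X : Matrix (Fin K) (Fin M) ℂ)
    (H : Matrix (Fin N) (Fin K) ℂ) (W : Matrix (Fin N) (Fin M) ℂ) : ℝ :=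
  let Hhat := channelEstimate N₀ d X (receivedPilots d X H W)
  Real.logb 2 (Matrix.det (1 + ((1 / noisePower P₀ N₀ d γ' X : ℝ) : ℂ) •
    (Hhat * fadingMatrix d * dataCovariance P₀ γ' * fadingMatrix d * Hhatᴴ))).re

/-- The joint law of the small-scale fading `H` (i.i.d. `CN(0,1)`) and the training noise `W_p`
(i.i.d. `CN(0,N₀)`), which are independent of each other. -/
def channelLaw (N K M : ℕ) (N₀ : ℝ) : Measure ((Fin N → Fin K → ℂ) × (Fin N → Fin M → ℂ)) :=
  (gaussianMatrixLaw N K 1).prod (gaussianMatrixLaw N M N₀)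

/-- The throughput `R = (1 - α) E[log₂ |I_N + σ_v⁻² Ĥ D R_{X_d} D Ĥ†|]` with `N` receive antennas,
as a function of the pilot matrix `X`. -/
def throughput {K M : ℕ} (N : ℕ) (α P₀ N₀ : ℝ) (d γ' : Fin K → ℝ)
    (X : Matrix (Fin K) (Fin M) ℂ) : ℝ :=
  (1 - α) * ∫ p, instantRate P₀ N₀ d γ' X (Matrix.of p.1) (Matrix.of p.2) ∂(channelLaw N K M N₀)

/-- The pilot matrices obeying the power constraint `(X_p X_p†)_diag = R_X`. -/
def feasiblePilots {K : ℕ} (M : ℕ) (α P₀ : ℝ) (T : ℕ) (γ : Fin K → ℝ) :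
    Set (Matrix (Fin K) (Fin M) ℂ) :=
  {X | Matrix.diagonal (X * Xᴴ).diag = trainingEnergy α P₀ T γ}

/-- `X` is an optimal pilot matrix: it maximizes the throughput among feasible pilot matrices. -/
def IsOptimalPilot {K M : ℕ} (N T : ℕ) (α P₀ N₀ : ℝ) (d γ γ' : Fin K → ℝ)
    (X : Matrix (Fin K) (Fin M) ℂ) : Prop :=
  X ∈ feasiblePilots M α P₀ T γ ∧
    IsMaxOn (throughput N α P₀ N₀ d γ') (feasiblePilots M α P₀ T γ) X

end

end MIMO

/-! Write fading and training noise as one matrix Z with independent `CN(0,1)` entries. The rows of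
the channel estimate are then rows of Z times a fixed matrix L, and the instantaneous rate is log
det(1 + Z Q Z†) up to the factor 1/log 2, with Q = ρ L L† and ρ a scalar (`instantRate_const`).

The law of Z is unitarily invariant, so the mean rate depends only on the eigenvalues of Q
(`meanRate_conj_unitary`). At most r = min(K, αT) of them are nonzero. Averaging them over cyclic
shifts of a support of size r leaves the mean rate of each term unchanged, so concavity of log det
shows that, for a given trace, r equal eigenvalues are best (`meanRate_le_of_rank_le`).

The common eigenvalue is tr Q / r, which is a strictly increasing function of one number, the
captured energy τ = tr(L†L): a larger τ strengthens the signal and lowers the equivalent noise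
(`effectiveSNR_lt`). Hence the throughput is at most G(τ) with G strictly increasing
(`meanRate_constOn_strictMono`), with equality when the nonzero eigenvalues are r equal ones.

It remains to maximize τ. It equals n − N₀ tr(d²A + N₀)⁻¹ both for the row Gram matrix A = XX†, n =
K, and for the column Gram matrix A = X†X, n = αT. The power constraint fixes tr A, and the
arithmetic-harmonic mean inequality makes τ largest exactly when A is scalar
(`card_sub_trace_inv_le`). The smaller Gram matrix can be scalar, and then the eigenvalues of Q are
equal as well, so both bounds are attained together. `isOptimalPilot_iff_of_estimateEnergy` combines
these facts; the witnesses are a truncated identity and a truncated Fourier matrix. -/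

namespace MIMO

open scoped ComplexOrder

/-! ### Concavity and monotonicity of log det on positive definite matrices -/

section LogDet

theorem posDef_one_add {n : Type*} [DecidableEq n] {P : Matrix n n ℂ} (hP : P.PosSemidef) :
    (1 + P).PosDef :=
  Matrix.PosDef.one.add_posSemidef hP

variable {n : Type*} [Fintype n] [DecidableEq n]

/-- Sum log x ≤ x − 1 over the eigenvalues. This is the tangent plane inequality at the identity. -/
theorem log_det_le_trace_sub_card {P : Matrix n n ℂ} (hP : P.PosDef) :
    Real.log P.det.re ≤ P.trace.re - Fintype.card n := by
  have hdet : P.det.re = ∏ i, hP.1.eigenvalues i := by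
    rw [hP.1.det_eq_prod_eigenvalues]
    norm_cast
  have htr : P.trace.re = ∑ i, hP.1.eigenvalues i := by
    rw [hP.1.trace_eq_sum_eigenvalues]
    norm_cast
  rw [hdet, htr, Real.log_prod fun i _ => (hP.eigenvalues_pos i).ne', Fintype.card,
    Finset.card_eq_sum_ones, Nat.cast_sum, ← Finset.sum_sub_distrib]
  refine Finset.sum_le_sum fun i _ => ?_
  simpa using Real.log_le_sub_one_of_pos (hP.eigenvalues_pos i)

theorem PosDef.exists_isUnit_conjTranspose_mul_self {A : Matrix n n ℂ} (hA : A.PosDef) :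
    ∃ T : Matrix n n ℂ, IsUnit T ∧ A = Tᴴ * T := by
  open scoped MatrixOrder in
  obtain ⟨T, hT⟩ := CStarAlgebra.nonneg_iff_eq_star_mul_self.mp hA.posSemidef.nonneg
  refine ⟨T, ?_, hT⟩
  have h := hA.isUnit
  rw [hT, Matrix.isUnit_iff_isUnit_det, Matrix.det_mul] at h
  exact (Matrix.isUnit_iff_isUnit_det T).2 (isUnit_of_mul_isUnit_right h)

theorem det_re_pos {A : Matrix n n ℂ} (hA : A.PosDef) : 0 < A.det.re :=
  (Complex.pos_iff.1 hA.det_pos).1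

theorem det_im_eq_zero {A : Matrix n n ℂ} (hA : A.PosDef) : A.det.im = 0 :=
  (Complex.pos_iff.1 hA.det_pos).2.symm

theorem log_det_mul {A B : Matrix n n ℂ} (hA : A.PosDef) (hB : B.PosDef) :
    Real.log (A * B).det.re = Real.log A.det.re + Real.log B.det.re := by
  rw [Matrix.det_mul, Complex.mul_re, det_im_eq_zero hA, zero_mul, sub_zero,
    Real.log_mul (det_re_pos hA).ne' (det_re_pos hB).ne']

theorem log_det_inv {A : Matrix n n ℂ} (hA : A.PosDef) :
    Real.log A⁻¹.det.re = -Real.log A.det.re := by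
  have h := log_det_mul hA hA.inv
  rw [Matrix.mul_nonsing_inv _ ((Matrix.isUnit_iff_isUnit_det A).1 hA.isUnit), Matrix.det_one,
    Complex.one_re, Real.log_one] at h
  linarith

/-- The tangent plane inequality of the concave function `log det`. -/
theorem log_det_le_tangent {A B : Matrix n n ℂ} (hA : A.PosDef) (hB : B.PosDef) :
    Real.log B.det.re ≤ Real.log A.det.re + ((A⁻¹ * B).trace.re - Fintype.card n) := by
  -- A⁻¹B need not be Hermitian, but with A⁻¹ = T†T the congruent matrix TBT† is, and it has the
  -- same trace and determinant. This reduces the claim to the tangent at the identity.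
  obtain ⟨T, hT, hAT⟩ := PosDef.exists_isUnit_conjTranspose_mul_self hA.inv
  have hP : (T * B * Tᴴ).PosDef := by
    simpa [Matrix.star_eq_conjTranspose] using (Matrix.IsUnit.posDef_star_right_conjugate_iff hT).2 hB
  have htr : (T * B * Tᴴ).trace = (A⁻¹ * B).trace := by
    rw [hAT, Matrix.trace_mul_comm, ← Matrix.mul_assoc]
  have hdet : (T * B * Tᴴ).det = (A⁻¹ * B).det := by
    rw [hAT]
    simp only [Matrix.det_mul]
    ring
  have h := log_det_le_trace_sub_card hP
  rw [htr, hdet, log_det_mul hA.inv hB, log_det_inv hA] at h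
  linarith

theorem trace_inv_mul_self {A : Matrix n n ℂ} (hA : A.PosDef) :
    (A⁻¹ * A).trace.re = Fintype.card n := by
  rw [Matrix.nonsing_inv_mul _ ((Matrix.isUnit_iff_isUnit_det A).1 hA.isUnit)]
  simp

theorem trace_mul_re_nonneg {A B : Matrix n n ℂ} (hA : A.PosDef) (hB : B.PosSemidef) :
    0 ≤ (A * B).trace.re ∧ ((A * B).trace.re = 0 → B = 0) := by
  obtain ⟨T, hT, hAT⟩ := PosDef.exists_isUnit_conjTranspose_mul_self hA
  have hP : (T * B * Tᴴ).PosSemidef := hB.mul_mul_conjTranspose_same T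
  have htr : (T * B * Tᴴ).trace = (A * B).trace := by
    rw [hAT, Matrix.trace_mul_comm, ← Matrix.mul_assoc]
  have h0 := Complex.nonneg_iff.1 hP.trace_nonneg
  rw [htr] at h0
  refine ⟨h0.1, fun h => ?_⟩
  have hz : T * B * Tᴴ = 0 := by
    rw [← hP.trace_eq_zero_iff, htr]
    exact Complex.ext h h0.2.symm
  have hT' : IsUnit Tᴴ := by simpa [Matrix.star_eq_conjTranspose] using hT.star
  rw [hT'.mul_left_eq_zero, hT.mul_right_eq_zero] at hz
  exact hz

theorem log_det_le_of_posSemidef_sub {A B : Matrix n n ℂ} (hA : A.PosDef) (hB : B.PosDef)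
    (h : (B - A).PosSemidef) : Real.log A.det.re ≤ Real.log B.det.re := by
  have h1 := log_det_le_tangent hB hA
  have h2 := (trace_mul_re_nonneg hB.inv h).1
  rw [Matrix.mul_sub, Matrix.trace_sub, Complex.sub_re, trace_inv_mul_self hB] at h2
  linarith

theorem log_det_lt_of_posSemidef_sub {A B : Matrix n n ℂ} (hA : A.PosDef) (hB : B.PosDef)
    (h : (B - A).PosSemidef) (hne : A ≠ B) : Real.log A.det.re < Real.log B.det.re := by
  have h1 := log_det_le_tangent hB hA
  have h2 := trace_mul_re_nonneg hB.inv h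
  have h3 : 0 < (B⁻¹ * (B - A)).trace.re :=
    lt_of_le_of_ne h2.1 fun h0 => hne (sub_eq_zero.1 (h2.2 h0.symm)).symm
  rw [Matrix.mul_sub, Matrix.trace_sub, Complex.sub_re, trace_inv_mul_self hB] at h3
  linarith

/-- Jensen's inequality for `log det`, for the uniform average of a finite family. -/
theorem sum_log_det_le {ι : Type*} [Fintype ι] {A : Matrix n n ℂ} {B : ι → Matrix n n ℂ}
    (hA : A.PosDef) (hB : ∀ j, (B j).PosDef) (h : ∑ j, B j = (Fintype.card ι : ℂ) • A) :
    ∑ j, Real.log (B j).det.re ≤ Fintype.card ι * Real.log A.det.re := by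
  -- Since A is the average of the B j, the linear terms of the tangents at A cancel in the sum.
  have key : ∑ j, (A⁻¹ * B j).trace.re = Fintype.card ι * Fintype.card n := by
    rw [← Complex.re_sum, ← Matrix.trace_sum, ← Matrix.mul_sum, h, Matrix.mul_smul,
      Matrix.trace_smul, smul_eq_mul, ← trace_inv_mul_self hA]
    simp
  calc ∑ j, Real.log (B j).det.re
      ≤ ∑ j, (Real.log A.det.re + ((A⁻¹ * B j).trace.re - Fintype.card n)) :=
        Finset.sum_le_sum fun j _ => log_det_le_tangent hA (hB j)
    _ = _ := by
        rw [Finset.sum_add_distrib, Finset.sum_sub_distrib, key]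
        simp

theorem log_det_one_add_nonneg {P : Matrix n n ℂ} (hP : P.PosSemidef) :
    0 ≤ Real.log (1 + P).det.re := by
  simpa using log_det_le_of_posSemidef_sub Matrix.PosDef.one (posDef_one_add hP) (by simpa using hP)

theorem log_det_one_add_le_trace {P : Matrix n n ℂ} (hP : P.PosSemidef) :
    Real.log (1 + P).det.re ≤ P.trace.re := by
  simpa using log_det_le_trace_sub_card (posDef_one_add hP)

/-- The inequality between arithmetic and harmonic means of the eigenvalues, with its case of
equality. -/
theorem card_sq_le_trace_mul_trace_inv {C : Matrix n n ℂ} (hC : C.PosDef) {c : ℝ} (hc : 0 < c)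
    (htr : C.trace.re = Fintype.card n * c) :
    Fintype.card n / c ≤ C⁻¹.trace.re ∧
      (C⁻¹.trace.re = Fintype.card n / c → C = (c : ℂ) • (1 : Matrix n n ℂ)) := by
  -- With tr C = nc, the nonnegative number tr(C⁻¹(C − c)²) equals c² tr C⁻¹ − nc, and it vanishes
  -- only for C = c.
  set E : Matrix n n ℂ := C - (c : ℂ) • 1 with hE
  have hEh : Eᴴ = E := by
    rw [hE, Matrix.conjTranspose_sub, Matrix.conjTranspose_smul, hC.1.eq]
    simp
  have hu := (Matrix.isUnit_iff_isUnit_det C).1 hC.isUnit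
  have hP : (E * Eᴴ).PosSemidef := Matrix.posSemidef_self_mul_conjTranspose E
  have hexp : C⁻¹ * (E * Eᴴ) = C - (2 * c : ℂ) • 1 + (c ^ 2 : ℂ) • C⁻¹ := by
    rw [hEh, hE, Matrix.sub_mul, Matrix.mul_sub, ← Matrix.mul_assoc, Matrix.nonsing_inv_mul _ hu]
    simp only [Matrix.mul_sub, Matrix.smul_mul, Matrix.mul_smul, Matrix.one_mul, Matrix.mul_one,
      Matrix.nonsing_inv_mul _ hu, smul_smul]
    module
  have h := trace_mul_re_nonneg hC.inv hP
  have htrace : (C⁻¹ * (E * Eᴴ)).trace.re = c ^ 2 * C⁻¹.trace.re - Fintype.card n * c := by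
    rw [hexp, Matrix.trace_add, Matrix.trace_sub, Matrix.trace_smul, Matrix.trace_smul,
      Matrix.trace_one, Complex.add_re, Complex.sub_re, htr, smul_eq_mul, smul_eq_mul,
      ← Complex.ofReal_pow, Complex.re_ofReal_mul, ← Complex.ofReal_ofNat, ← Complex.ofReal_mul,
      Complex.re_ofReal_mul, Complex.natCast_re]
    ring
  rw [htrace] at h
  refine ⟨?_, fun heq => ?_⟩
  · rw [div_le_iff₀ hc]
    nlinarith [h.1]
  · have h0 := h.2 (by rw [heq]; field_simp; ring)
    rw [Matrix.self_mul_conjTranspose_eq_zero] at h0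
    exact sub_eq_zero.1 h0

end LogDet

/-! ### The scalar complex Gaussian law -/

section Gaussian

instance (v : ℝ) : IsProbabilityMeasure (complexGaussian v) := by
  unfold complexGaussian
  exact Measure.isProbabilityMeasure_map
    (Complex.measurableEquivRealProd.symm.measurable.aemeasurable)

theorem measurePreserving_complexGaussian (v : ℝ) :
    MeasurePreserving Complex.measurableEquivRealProd.symm
      ((gaussianReal 0 (v / 2).toNNReal).prod (gaussianReal 0 (v / 2).toNNReal))
      (complexGaussian v) :=
  ⟨Complex.measurableEquivRealProd.symm.measurable, rfl⟩

theorem charFun_complexGaussian {v : ℝ} (hv : 0 ≤ v) (t : ℂ) :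
    charFun (complexGaussian v) t = Complex.exp (-(v * ‖t‖ ^ 2 / 4 : ℝ)) := by
  have h1 : charFun (complexGaussian v) t =
      charFun (gaussianReal 0 (v / 2).toNNReal) t.re *
        charFun (gaussianReal 0 (v / 2).toNNReal) t.im := by
    rw [charFun_apply, ← (measurePreserving_complexGaussian v).integral_comp'
      (g := fun x : ℂ => Complex.exp (inner ℝ x t * Complex.I)), charFun_apply_real,
      charFun_apply_real, ← integral_prod_mul]
    refine integral_congr_ae (Filter.Eventually.of_forall fun p => ?_)
    simp only
    rw [← Complex.exp_add]
    congr 1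
    simp [Complex.inner]
    ring
  rw [h1, charFun_gaussianReal, charFun_gaussianReal, ← Complex.exp_add, ← Complex.normSq_eq_norm_sq,
    Complex.normSq_apply]
  congr 1
  simp [Real.coe_toNNReal _ (div_nonneg hv zero_le_two)]
  ring

theorem map_mul_complexGaussian {c v : ℝ} (hv : 0 ≤ v) :
    (complexGaussian v).map (fun z : ℂ => (c : ℂ) * z) = complexGaussian (c ^ 2 * v) := by
  have hmeas : Measurable fun z : ℂ => (c : ℂ) * z := by fun_prop
  have : IsProbabilityMeasure ((complexGaussian v).map fun z : ℂ => (c : ℂ) * z) :=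
    Measure.isProbabilityMeasure_map hmeas.aemeasurable
  refine Measure.ext_of_charFun ?_
  ext t
  have h : (fun z : ℂ => (c : ℂ) * z) = fun z => c • z := by
    ext z
    simp
  rw [h, charFun_map_smul, charFun_complexGaussian hv, charFun_complexGaussian (by positivity),
    norm_smul, mul_pow, Real.norm_eq_abs, sq_abs]
  ring_nf

theorem memLp_two_complexGaussian (v : ℝ) : MemLp (fun z : ℂ => z) 2 (complexGaussian v) := by
  have hre : MemLp (fun z : ℂ => z.re) 2 (complexGaussian v) := by
    rw [← (measurePreserving_complexGaussian v).map_eq, memLp_map_measure_iff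
      (by fun_prop) (by fun_prop)]
    exact (IsGaussian.memLp_two_id (μ := gaussianReal 0 (v / 2).toNNReal)).comp_measurePreserving
      measurePreserving_fst
  have him : MemLp (fun z : ℂ => z.im) 2 (complexGaussian v) := by
    rw [← (measurePreserving_complexGaussian v).map_eq, memLp_map_measure_iff
      (by fun_prop) (by fun_prop)]
    exact (IsGaussian.memLp_two_id (μ := gaussianReal 0 (v / 2).toNNReal)).comp_measurePreserving
      measurePreserving_snd
  exact memLp_re_im_iff.1 ⟨hre, him⟩

theorem integrable_normSq_complexGaussian (v : ℝ) :
    Integrable (fun z : ℂ => Complex.normSq z) (complexGaussian v) := by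
  simpa [Complex.normSq_eq_norm_sq] using (memLp_two_complexGaussian v).integrable_norm_pow two_ne_zero

/-- This is the source of strictness: an entry of the normalized matrix is almost surely nonzero. -/
theorem complexGaussian_one_singleton_zero : complexGaussian 1 {0} = 0 := by
  have h : NullSingletonClass (gaussianReal 0 ((1 : ℝ) / 2).toNNReal) :=
    nullSingletonClass_gaussianReal (by simp)
  rw [← (measurePreserving_complexGaussian 1).measure_preimage_equiv]
  have : (Complex.measurableEquivRealProd.symm ⁻¹' {0}) ⊆ ({0} : Set ℝ) ×ˢ Set.univ := by
    rintro ⟨a, b⟩ hab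
    have : (⟨a, b⟩ : ℂ) = 0 := hab
    simpa using congrArg Complex.re this
  refine measure_mono_null this ?_
  rw [Measure.prod_prod, measure_singleton, zero_mul]

end Gaussian

/-! ### Unitary invariance and normalization of Gaussian matrices -/

section GaussianMatrix

/-- The law of an `N × ι` matrix with independent `CN(0, 1)` entries. -/
noncomputable def stdMatrixLaw (N : ℕ) (ι : Type*) [Fintype ι] : Measure (Fin N → ι → ℂ) :=
  Measure.pi fun _ => Measure.pi fun _ => complexGaussian 1

variable {N : ℕ} {ι : Type*} [Fintype ι]

instance : IsProbabilityMeasure (stdMatrixLaw N ι) := by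
  unfold stdMatrixLaw
  infer_instance

theorem measurePreserving_entry (i : Fin N) (j : ι) :
    MeasurePreserving (fun Z : Fin N → ι → ℂ => Z i j) (stdMatrixLaw N ι) (complexGaussian 1) :=
  (measurePreserving_eval (fun _ : ι => complexGaussian 1) j).comp
    (measurePreserving_eval (fun _ : Fin N => Measure.pi fun _ : ι => complexGaussian 1) i)

/-- The characteristic function depends on t only through its Euclidean norm, which gives unitary
invariance. -/
theorem charFun_map_toLp_pi (t : PiLp 2 fun _ : ι => ℂ) :
    charFun ((Measure.pi fun _ : ι => complexGaussian 1).map (WithLp.toLp 2)) t =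
      Complex.exp (-(‖t‖ ^ 2 / 4 : ℝ)) := by
  rw [charFun_pi, PiLp.norm_sq_eq_of_L2, Finset.sum_div, Complex.ofReal_sum,
    ← Finset.sum_neg_distrib, Complex.exp_sum]
  refine Finset.prod_congr rfl fun i _ => ?_
  rw [charFun_complexGaussian zero_le_one, one_mul]

/-- Unitary invariance of the law of a vector with independent `CN(0, 1)` coordinates. -/
theorem measurePreserving_vecMul_unitary [DecidableEq ι] {U : Matrix ι ι ℂ}
    (hU : U ∈ Matrix.unitaryGroup ι ℂ) :
    MeasurePreserving (fun z : ι → ℂ => z ᵥ* U) (Measure.pi fun _ : ι => complexGaussian 1)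
      (Measure.pi fun _ : ι => complexGaussian 1) := by
  have hcont : Continuous fun z : ι → ℂ => z ᵥ* U := by fun_prop
  refine ⟨hcont.measurable, ?_⟩
  set ν := Measure.pi fun _ : ι => complexGaussian 1
  have hmt : Measurable (WithLp.toLp 2 : (ι → ℂ) → PiLp 2 fun _ : ι => ℂ) := by fun_prop
  -- Characteristic functions need the Euclidean inner product, whereas the plain function space
  -- carries the sup norm.
  suffices h : (ν.map fun z => z ᵥ* U).map (WithLp.toLp 2 : (ι → ℂ) → PiLp 2 fun _ : ι => ℂ) =
      ν.map (WithLp.toLp 2) by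
    have h2 := congrArg (Measure.map (WithLp.ofLp : (PiLp 2 fun _ : ι => ℂ) → ι → ℂ)) h
    rw [Measure.map_map (by fun_prop) hmt, Measure.map_map (by fun_prop) hmt] at h2
    have hid : (WithLp.ofLp : (PiLp 2 fun _ : ι => ℂ) → ι → ℂ) ∘ WithLp.toLp 2 = id := rfl
    simpa [hid] using h2
  have : IsProbabilityMeasure (ν.map fun z => z ᵥ* U) :=
    Measure.isProbabilityMeasure_map hcont.measurable.aemeasurable
  have : IsProbabilityMeasure ((ν.map fun z => z ᵥ* U).map
      (WithLp.toLp 2 : (ι → ℂ) → PiLp 2 fun _ : ι => ℂ)) :=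
    Measure.isProbabilityMeasure_map hmt.aemeasurable
  have : IsProbabilityMeasure (ν.map (WithLp.toLp 2 : (ι → ℂ) → PiLp 2 fun _ : ι => ℂ)) :=
    Measure.isProbabilityMeasure_map hmt.aemeasurable
  refine Measure.ext_of_charFun ?_
  ext t
  have hdot : ∀ a b : ι → ℂ, inner ℝ (WithLp.toLp 2 a : PiLp 2 fun _ : ι => ℂ) (WithLp.toLp 2 b) =
      (b ⬝ᵥ star a).re := by
    intro a b
    simp only [PiLp.inner_apply, dotProduct, Complex.re_sum, Complex.inner, Pi.star_apply]
    exact Finset.sum_congr rfl fun i _ => rfl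
  have hinner : ∀ z : ι → ℂ, inner ℝ (WithLp.toLp 2 (z ᵥ* U) : PiLp 2 fun _ : ι => ℂ) t =
      inner ℝ (WithLp.toLp 2 z : PiLp 2 fun _ : ι => ℂ) (WithLp.toLp 2 (t.ofLp ᵥ* Uᴴ)) := by
    intro z
    rw [← WithLp.toLp_ofLp 2 t, hdot, hdot, Matrix.star_vecMul, Matrix.dotProduct_mulVec]
  have hnorm : ‖(WithLp.toLp 2 (t.ofLp ᵥ* Uᴴ) : PiLp 2 fun _ : ι => ℂ)‖ = ‖t‖ := by
    rw [← sq_eq_sq₀ (norm_nonneg _) (norm_nonneg _), ← real_inner_self_eq_norm_sq,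
      ← real_inner_self_eq_norm_sq, ← hinner, Matrix.vecMul_vecMul,
      ← Matrix.star_eq_conjTranspose, (Matrix.mem_unitaryGroup_iff').1 hU, Matrix.vecMul_one]
  have hchar : charFun ((ν.map fun z => z ᵥ* U).map
      (WithLp.toLp 2 : (ι → ℂ) → PiLp 2 fun _ : ι => ℂ)) t =
      charFun (ν.map (WithLp.toLp 2)) (WithLp.toLp 2 (t.ofLp ᵥ* Uᴴ)) := by
    rw [charFun_apply, charFun_apply, Measure.map_map hmt hcont.measurable,
      integral_map (hmt.comp hcont.measurable).aemeasurable (by fun_prop),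
      integral_map hmt.aemeasurable (by fun_prop)]
    simp only [Function.comp_apply, hinner]
  rw [hchar, charFun_map_toLp_pi, charFun_map_toLp_pi, hnorm]

theorem measurePreserving_mul_unitary [DecidableEq ι] {U : Matrix ι ι ℂ}
    (hU : U ∈ Matrix.unitaryGroup ι ℂ) :
    MeasurePreserving (fun Z : Fin N → ι → ℂ => fun i => Z i ᵥ* U) (stdMatrixLaw N ι)
      (stdMatrixLaw N ι) :=
  measurePreserving_pi _ _ fun _ => measurePreserving_vecMul_unitary hU

/-- A family of independent `CN(0, 1)` entries indexed by `Fin K ⊕ Fin M` is, up to scaling the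
entries of the second block, the pair of the fading and the training noise. -/
theorem measurePreserving_channel {K M : ℕ} {N₀ : ℝ} (hN₀ : 0 < N₀) :
    MeasurePreserving
      (fun Z : Fin N → (Fin K ⊕ Fin M) → ℂ =>
        ((fun i k => Z i (Sum.inl k) : Fin N → Fin K → ℂ),
          (fun i m => (Real.sqrt N₀ : ℂ) * Z i (Sum.inr m) : Fin N → Fin M → ℂ)))
      (stdMatrixLaw N (Fin K ⊕ Fin M)) (channelLaw N K M N₀) := by
  have hscale : MeasurePreserving (fun z : ℂ => (Real.sqrt N₀ : ℂ) * z) (complexGaussian 1)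
      (complexGaussian N₀) := by
    refine ⟨by fun_prop, ?_⟩
    rw [map_mul_complexGaussian zero_le_one, Real.sq_sqrt hN₀.le, mul_one]
  have hsplit : MeasurePreserving
      (fun z : (Fin K ⊕ Fin M) → ℂ => ((fun k => z (Sum.inl k)), (fun m => z (Sum.inr m))))
      (Measure.pi fun _ => complexGaussian 1)
      ((Measure.pi fun _ => complexGaussian 1).prod (Measure.pi fun _ => complexGaussian 1)) :=
    measurePreserving_sumPiEquivProdPi fun _ : Fin K ⊕ Fin M => complexGaussian 1
  have hrow : MeasurePreserving
      (fun z : (Fin K ⊕ Fin M) → ℂ => ((fun k => z (Sum.inl k)),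
        (fun m => (Real.sqrt N₀ : ℂ) * z (Sum.inr m))))
      (Measure.pi fun _ => complexGaussian 1)
      ((Measure.pi fun _ => complexGaussian 1).prod (Measure.pi fun _ => complexGaussian N₀)) :=
    ((MeasurePreserving.id _).prod (measurePreserving_pi _ _ fun _ => hscale)).comp hsplit
  exact (measurePreserving_arrowProdEquivProdArrow _ _ (Fin N) _ _).comp
    (measurePreserving_pi _ _ fun _ : Fin N => hrow)

end GaussianMatrix

/-! ### Real diagonal matrices -/

section Diagonal

variable {ι : Type*} [DecidableEq ι]

/-- The function with value `c` on `S` and `0` elsewhere. -/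
noncomputable def constOn (S : Finset ι) (c : ℝ) : ι → ℝ :=
  fun j => if j ∈ S then c else 0

theorem constOn_nonneg (S : Finset ι) {c : ℝ} (hc : 0 ≤ c) (j : ι) : 0 ≤ constOn S c j := by
  unfold constOn
  split_ifs <;> simp [hc]

/-- The complex diagonal matrix with given real entries. -/
noncomputable def realDiagonal (l : ι → ℝ) : Matrix ι ι ℂ :=
  Matrix.diagonal fun j => (l j : ℂ)

theorem posSemidef_realDiagonal {l : ι → ℝ} (hl : ∀ j, 0 ≤ l j) :
    (realDiagonal l).PosSemidef :=
  Matrix.PosSemidef.diagonal fun j => by simpa using hl j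

end Diagonal

/-! ### The mean rate as a function of the spectrum -/

section MeanRate

variable {N : ℕ} {ι : Type*} [Fintype ι]

/-- The expectation of `log det(1 + Z Q Z†)` for an `N × ι` matrix `Z` with independent `CN(0, 1)`
entries. -/
noncomputable def meanRate (N : ℕ) (Q : Matrix ι ι ℂ) : ℝ :=
  ∫ Z, Real.log (1 + Matrix.of Z * Q * (Matrix.of Z)ᴴ).det.re ∂(stdMatrixLaw N ι)

theorem measurable_log_det_re {α : Type*} [TopologicalSpace α] [MeasurableSpace α] [BorelSpace α]
    {F : α → Matrix (Fin N) (Fin N) ℂ} (hF : Continuous F) :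
    Measurable fun a => Real.log (F a).det.re :=
  Real.measurable_log.comp (Complex.continuous_re.comp hF.matrix_det).measurable

theorem continuous_one_add_mul_mul_conjTranspose (Q : Matrix ι ι ℂ) :
    Continuous fun Z : Fin N → ι → ℂ => 1 + Matrix.of Z * Q * (Matrix.of Z)ᴴ := by
  have h : Continuous fun Z : Fin N → ι → ℂ => Matrix.of Z := continuous_id
  exact continuous_const.add ((h.matrix_mul continuous_const).matrix_mul h.matrix_conjTranspose)

theorem measurable_rate (Q : Matrix ι ι ℂ) : Measurable fun Z : Fin N → ι → ℂ =>
    Real.log (1 + Matrix.of Z * Q * (Matrix.of Z)ᴴ).det.re :=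
  measurable_log_det_re (continuous_one_add_mul_mul_conjTranspose Q)

theorem rate_conj (U Q : Matrix ι ι ℂ) (Z : Fin N → ι → ℂ) :
    Matrix.of Z * (U * Q * Uᴴ) * (Matrix.of Z)ᴴ =
      Matrix.of (fun i => Z i ᵥ* U) * Q * (Matrix.of fun i => Z i ᵥ* U)ᴴ := by
  have h : Matrix.of (fun i => Z i ᵥ* U) = Matrix.of Z * U := by
    ext i j
    rfl
  simp only [h, Matrix.conjTranspose_mul, Matrix.mul_assoc]

variable [DecidableEq ι]

/-- The unitary is absorbed into Z, whose law it preserves. -/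
theorem meanRate_conj_unitary {U : Matrix ι ι ℂ} (hU : U ∈ Matrix.unitaryGroup ι ℂ)
    (Q : Matrix ι ι ℂ) : meanRate N (U * Q * Uᴴ) = meanRate N Q := by
  have h := measurePreserving_mul_unitary (N := N) hU
  unfold meanRate
  conv_rhs => rw [← h.map_eq]
  rw [integral_map h.measurable.aemeasurable (measurable_rate Q).aestronglyMeasurable]
  simp only [rate_conj]

theorem trace_mul_realDiagonal_mul (l : ι → ℝ) (Z : Fin N → ι → ℂ) :
    (Matrix.of Z * realDiagonal l * (Matrix.of Z)ᴴ).trace.re =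
      ∑ i, ∑ j, l j * Complex.normSq (Z i j) := by
  simp only [Matrix.trace, Matrix.diag_apply, Complex.re_sum, realDiagonal, Matrix.mul_apply (N := _ᴴ),
    Matrix.mul_diagonal, Matrix.conjTranspose_apply, Matrix.of_apply]
  refine Finset.sum_congr rfl fun i _ => Finset.sum_congr rfl fun j _ => ?_
  rw [mul_right_comm, Complex.star_def, Complex.mul_conj, ← Complex.ofReal_mul, Complex.ofReal_re,
    mul_comm]

theorem exists_unitary_eq_realDiagonal {Q : Matrix ι ι ℂ} (hQ : Q.IsHermitian) :
    ∃ U ∈ Matrix.unitaryGroup ι ℂ, Q = U * realDiagonal hQ.eigenvalues * Uᴴ := by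
  refine ⟨hQ.eigenvectorUnitary, hQ.eigenvectorUnitary.2, ?_⟩
  conv_lhs => rw [hQ.spectral_theorem, Unitary.conjStarAlgAut_apply]
  rfl

/-- The rate lies between 0 and the trace of Z diag(l) Z†, a combination of the integrable variables
|Z i j|². -/
theorem integrable_rate_realDiagonal {l : ι → ℝ} (hl : ∀ j, 0 ≤ l j) :
    Integrable (fun Z : Fin N → ι → ℂ =>
      Real.log (1 + Matrix.of Z * realDiagonal l * (Matrix.of Z)ᴴ).det.re) (stdMatrixLaw N ι) := by
  have hb : Integrable (fun Z : Fin N → ι → ℂ => ∑ i, ∑ j, l j * Complex.normSq (Z i j))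
      (stdMatrixLaw N ι) := by
    refine integrable_finsetSum _ fun i _ => integrable_finsetSum _ fun j _ => Integrable.const_mul ?_ _
    exact (measurePreserving_entry i j).integrable_comp_of_integrable
      (integrable_normSq_complexGaussian 1)
  refine hb.mono' (measurable_rate _).aestronglyMeasurable (Filter.Eventually.of_forall fun Z => ?_)
  have hP := (posSemidef_realDiagonal hl).mul_mul_conjTranspose_same (Matrix.of Z)
  rw [Real.norm_eq_abs, abs_of_nonneg (log_det_one_add_nonneg hP), ← trace_mul_realDiagonal_mul]
  exact log_det_one_add_le_trace hP

theorem integrable_rate {Q : Matrix ι ι ℂ} (hQ : Q.PosSemidef) :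
    Integrable (fun Z : Fin N → ι → ℂ =>
      Real.log (1 + Matrix.of Z * Q * (Matrix.of Z)ᴴ).det.re) (stdMatrixLaw N ι) := by
  obtain ⟨U, hU, hQU⟩ := exists_unitary_eq_realDiagonal hQ.1
  rw [hQU]
  simp only [rate_conj]
  exact (measurePreserving_mul_unitary hU).integrable_comp_of_integrable
    (integrable_rate_realDiagonal hQ.eigenvalues_nonneg)

/-- Permutation matrices are unitary. -/
theorem meanRate_realDiagonal_comp_perm (l : ι → ℝ) (σ : Equiv.Perm ι) :
    meanRate N (realDiagonal (l ∘ σ)) = meanRate N (realDiagonal l) := by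
  set U : Matrix ι ι ℂ := (1 : Matrix ι ι ℂ).submatrix σ id with hU
  have hUs : Uᴴ = (1 : Matrix ι ι ℂ).submatrix id σ := by
    rw [hU, Matrix.conjTranspose_submatrix, Matrix.conjTranspose_one]
  have hmem : U ∈ Matrix.unitaryGroup ι ℂ := by
    rw [Matrix.mem_unitaryGroup_iff, Matrix.star_eq_conjTranspose, hUs, hU]
    ext i j
    simp [Matrix.mul_apply, Matrix.one_apply]
  rw [← meanRate_conj_unitary hmem (realDiagonal l)]
  congr 1
  rw [hUs, hU]
  ext i j
  simp only [realDiagonal, Matrix.diagonal_apply, Function.comp_apply, Matrix.mul_apply,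
    Matrix.submatrix_apply, Matrix.one_apply, id_eq]
  by_cases hij : i = j
  · simp [hij]
  · simp [hij]

theorem exists_perm_mem_iff {S R : Finset ι} (h : S.card = R.card) :
    ∃ σ : Equiv.Perm ι, ∀ j, σ j ∈ R ↔ j ∈ S := by
  refine ⟨(Finset.equivOfCardEq h).extendSubtype, fun j => ⟨fun hj => ?_, fun hj => ?_⟩⟩
  · by_contra hS
    exact Equiv.extendSubtype_not_mem _ j hS hj
  · exact Equiv.extendSubtype_mem _ j hj

theorem meanRate_constOn_eq {S R : Finset ι} (h : S.card = R.card) (c : ℝ) :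
    meanRate N (realDiagonal (constOn S c)) = meanRate N (realDiagonal (constOn R c)) := by
  obtain ⟨σ, hσ⟩ := exists_perm_mem_iff h
  rw [← meanRate_realDiagonal_comp_perm (constOn R c) σ]
  congr 2
  ext j
  simp [constOn, hσ]

/-- Averaging over cyclic permutations of a set containing the support. -/
theorem sum_cyclic_perm {S : Finset ι} (hS : S.Nonempty) :
    ∃ σ : Fin S.card → Equiv.Perm ι, ∀ l : ι → ℝ, (∀ j, j ∉ S → l j = 0) → ∀ j,
      ∑ a, l (σ a j) = constOn S (∑ j, l j) j := by
  have : NeZero S.card := ⟨hS.card_pos.ne'⟩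
  set e : Fin S.card ↪ ι := S.equivFin.symm.toEmbedding.trans (Function.Embedding.subtype _) with he
  have hrange : ∀ j, j ∈ Set.range e ↔ j ∈ S := by
    intro j
    constructor
    · rintro ⟨a, rfl⟩
      exact (S.equivFin.symm a).2
    · intro hj
      exact ⟨S.equivFin ⟨j, hj⟩, by simp [he]⟩
  -- The shift b ↦ b + a of `Fin S.card` is carried to S and extended by the identity. As a varies,
  -- the orbit of a point of S runs through S exactly once.
  refine ⟨fun a => (Equiv.addRight a : Equiv.Perm (Fin S.card)).viaEmbedding e, fun l hl j => ?_⟩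
  have hsum : ∑ b, l (e b) = ∑ j, l j := by
    rw [← Finset.sum_subset (Finset.subset_univ S) fun j _ hj => hl j hj, ← Finset.sum_coe_sort S,
      ← S.equivFin.symm.sum_comp]
    rfl
  unfold constOn
  split_ifs with hj
  · obtain ⟨b, rfl⟩ := (hrange j).2 hj
    simp only [Equiv.Perm.viaEmbedding_apply, Equiv.coe_addRight]
    rw [← hsum]
    exact Equiv.sum_comp (Equiv.addLeft b) fun c => l (e c)
  · refine Finset.sum_eq_zero fun a _ => ?_
    rw [Equiv.Perm.viaEmbedding_apply_of_notMem _ _ _ (by rwa [hrange])]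
    exact hl j hj

/-- The cyclic rearrangements of l all have the same mean rate, and their average is constant on S.
Jensen's inequality for log det, applied for each Z and integrated, compares the two. -/
theorem meanRate_realDiagonal_le {l : ι → ℝ} (hl : ∀ j, 0 ≤ l j) {S : Finset ι} (hS : S.Nonempty)
    (hsupp : ∀ j, j ∉ S → l j = 0) :
    meanRate N (realDiagonal l) ≤ meanRate N (realDiagonal (constOn S ((∑ j, l j) / S.card))) := by
  obtain ⟨σ, hσ⟩ := sum_cyclic_perm hS
  have hr : (0 : ℝ) < S.card := by exact_mod_cast hS.card_pos
  have hl' : ∀ j, 0 ≤ constOn S ((∑ j, l j) / S.card) j :=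
    constOn_nonneg S (div_nonneg (Finset.sum_nonneg fun j _ => hl j) hr.le)
  have hmat : ∑ a, realDiagonal (l ∘ σ a) =
      (S.card : ℂ) • realDiagonal (constOn S ((∑ j, l j) / S.card)) := by
    ext i j
    rw [Matrix.sum_apply]
    by_cases hij : i = j
    · subst hij
      simp only [realDiagonal, Matrix.diagonal_apply_eq, Matrix.smul_apply, Function.comp_apply,
        smul_eq_mul]
      rw [← Complex.ofReal_sum, hσ l hsupp, ← Complex.ofReal_natCast, ← Complex.ofReal_mul]
      congr 1
      unfold constOn
      split_ifs
      · field_simp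
      · simp
    · simp [realDiagonal, hij]
  have hpt : ∀ Z : Fin N → ι → ℂ,
      ∑ a, Real.log (1 + Matrix.of Z * realDiagonal (l ∘ σ a) * (Matrix.of Z)ᴴ).det.re ≤
      S.card * Real.log (1 + Matrix.of Z * realDiagonal (constOn S ((∑ j, l j) / S.card)) *
        (Matrix.of Z)ᴴ).det.re := by
    intro Z
    have h := sum_log_det_le (ι := Fin S.card)
      (A := 1 + Matrix.of Z * realDiagonal (constOn S ((∑ j, l j) / S.card)) * (Matrix.of Z)ᴴ)
      (B := fun a => 1 + Matrix.of Z * realDiagonal (l ∘ σ a) * (Matrix.of Z)ᴴ)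
      (posDef_one_add ((posSemidef_realDiagonal hl').mul_mul_conjTranspose_same _))
      (fun a => posDef_one_add ((posSemidef_realDiagonal fun j => hl _).mul_mul_conjTranspose_same _))
      (by
        rw [Finset.sum_add_distrib, ← Matrix.sum_mul, ← Matrix.mul_sum, hmat, Matrix.mul_smul,
          Matrix.smul_mul, smul_add, Fintype.card_fin, Finset.sum_const, Finset.card_univ,
          Fintype.card_fin]
        simp only [Nat.cast_smul_eq_nsmul])
    simpa using h
  have hint := integral_mono
    (integrable_finsetSum Finset.univ fun (a : Fin S.card) _ => integrable_rate_realDiagonal (N := N)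
      (l := l ∘ σ a) fun j => hl _)
    ((integrable_rate_realDiagonal (N := N) hl').const_mul (S.card : ℝ)) hpt
  rw [integral_finsetSum _ fun a _ => integrable_rate_realDiagonal (l := l ∘ σ a) fun j => hl _,
    integral_const_mul] at hint
  change ∑ a, meanRate N (realDiagonal (l ∘ σ a)) ≤ S.card * meanRate N _ at hint
  simp only [meanRate_realDiagonal_comp_perm, Finset.sum_const, Finset.card_univ, Fintype.card_fin,
    nsmul_eq_mul] at hint
  exact le_of_mul_le_mul_left hint hr

theorem trace_re_eq_sum_eigenvalues {Q : Matrix ι ι ℂ} (hQ : Q.IsHermitian) :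
    Q.trace.re = ∑ j, hQ.eigenvalues j := by
  rw [hQ.trace_eq_sum_eigenvalues]
  norm_cast

theorem meanRate_eq_realDiagonal {Q : Matrix ι ι ℂ} (hQ : Q.IsHermitian) :
    meanRate N Q = meanRate N (realDiagonal hQ.eigenvalues) := by
  obtain ⟨U, hU, hQU⟩ := exists_unitary_eq_realDiagonal hQ
  conv_lhs => rw [hQU]
  exact meanRate_conj_unitary hU _

/-- Among the positive semidefinite matrices of given trace and of rank at most `#R`, the mean rate
is largest for the multiples of projections of rank `#R`. -/
theorem meanRate_le_of_rank_le {Q : Matrix ι ι ℂ} (hQ : Q.PosSemidef) {R : Finset ι}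
    (hR : R.Nonempty) (hrank : Q.rank ≤ R.card) :
    meanRate N Q ≤ meanRate N (realDiagonal (constOn R (Q.trace.re / R.card))) := by
  have hcard : (Finset.univ.filter fun j => hQ.1.eigenvalues j ≠ 0).card ≤ R.card := by
    rwa [hQ.1.rank_eq_card_non_zero_eigs, Fintype.card_subtype] at hrank
  -- The rank may be smaller than the size of R, so the support is padded with zero eigenvalues.
  obtain ⟨S, hS, hSR⟩ := Finset.exists_superset_card_eq hcard R.card_le_univ
  rw [meanRate_eq_realDiagonal hQ.1, trace_re_eq_sum_eigenvalues hQ.1, ← meanRate_constOn_eq hSR,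
    ← hSR]
  refine meanRate_realDiagonal_le hQ.eigenvalues_nonneg
    (Finset.card_pos.1 (hSR ▸ hR.card_pos)) fun j hj => ?_
  by_contra h
  exact hj (hS (by simp [h]))

/-- The quadratic relation leaves only the eigenvalues 0 and s, and the trace counts how often s
occurs. -/
theorem meanRate_eq_of_mul_self_eq {Q : Matrix ι ι ℂ} (hQ : Q.IsHermitian) {R : Finset ι} {s : ℝ}
    (hQQ : Q * Q = (s : ℂ) • Q) (htr : Q.trace.re = R.card * s) :
    meanRate N Q = meanRate N (realDiagonal (constOn R s)) := by
  obtain ⟨U, hU, hQU⟩ := exists_unitary_eq_realDiagonal hQ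
  have hUU : Uᴴ * U = 1 := (Matrix.mem_unitaryGroup_iff').1 hU
  set D := realDiagonal hQ.eigenvalues with hD
  have hDQ : Uᴴ * Q * U = D := by
    calc Uᴴ * Q * U = (Uᴴ * U) * D * (Uᴴ * U) := by
          conv_lhs => rw [hQU]
          simp only [Matrix.mul_assoc]
      _ = D := by rw [hUU, Matrix.one_mul, Matrix.mul_one]
  have hUU' : U * Uᴴ = 1 := (Matrix.mem_unitaryGroup_iff).1 hU
  have hDD : D * D = (s : ℂ) • D := by
    calc D * D = Uᴴ * Q * (U * Uᴴ) * Q * U := by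
          conv_lhs => rw [← hDQ]
          simp only [Matrix.mul_assoc]
      _ = Uᴴ * (Q * Q) * U := by rw [hUU', Matrix.mul_one, Matrix.mul_assoc Uᴴ]
      _ = (s : ℂ) • D := by rw [hQQ, Matrix.mul_smul, Matrix.smul_mul, hDQ]
  have heig : ∀ j, hQ.eigenvalues j = 0 ∨ hQ.eigenvalues j = s := by
    intro j
    have h := congrFun (congrFun hDD j) j
    simp only [hD, realDiagonal, Matrix.diagonal_mul_diagonal, Matrix.diagonal_apply_eq,
      Matrix.smul_apply, smul_eq_mul] at h
    norm_cast at h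
    by_cases h0 : hQ.eigenvalues j = 0
    · exact Or.inl h0
    · exact Or.inr (mul_right_cancel₀ h0 h)
  set S := Finset.univ.filter fun j => hQ.eigenvalues j ≠ 0 with hS
  have hl : hQ.eigenvalues = constOn S s := by
    ext j
    by_cases h0 : hQ.eigenvalues j = 0
    · simp [constOn, hS, h0]
    · simpa [constOn, hS, h0] using (heig j).resolve_left h0
  rw [meanRate_eq_realDiagonal hQ, hl]
  -- For s = 0 the trace does not determine the size of S, but both diagonals vanish.
  by_cases hs : s = 0
  · have h0 : ∀ S' : Finset ι, constOn S' (0 : ℝ) = fun _ => 0 := fun S' => by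
      ext j
      exact ite_self 0
    rw [hs, h0, h0]
  · refine meanRate_constOn_eq ?_ s
    rw [trace_re_eq_sum_eigenvalues hQ, hl] at htr
    have hsum : ∑ j, constOn S s j = S.card * s := by
      simp [constOn, Finset.sum_ite_mem]
    rw [hsum] at htr
    exact_mod_cast mul_right_cancel₀ hs htr

/-- The rate is monotone for every Z. Equal integrals would force equality almost everywhere, hence
at some Z with a nonzero entry in a column of R, where the increment (b − a) Z 1_R Z† is nonzero. -/
theorem meanRate_constOn_strictMono (hN : 0 < N) {R : Finset ι} (hR : R.Nonempty) {a b : ℝ}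
    (ha : 0 ≤ a) (hab : a < b) :
    meanRate N (realDiagonal (constOn R a)) < meanRate N (realDiagonal (constOn R b)) := by
  obtain ⟨j₀, hj₀⟩ := hR
  have hb := ha.trans hab.le
  have hPD : ∀ c : ℝ, 0 ≤ c → ∀ Z : Fin N → ι → ℂ,
      (1 + Matrix.of Z * realDiagonal (constOn R c) * (Matrix.of Z)ᴴ).PosDef := fun c hc Z =>
    posDef_one_add ((posSemidef_realDiagonal (constOn_nonneg R hc)).mul_mul_conjTranspose_same _)
  have hsub : ∀ Z : Fin N → ι → ℂ,
      (1 + Matrix.of Z * realDiagonal (constOn R b) * (Matrix.of Z)ᴴ) -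
        (1 + Matrix.of Z * realDiagonal (constOn R a) * (Matrix.of Z)ᴴ) =
      Matrix.of Z * realDiagonal (constOn R (b - a)) * (Matrix.of Z)ᴴ := by
    intro Z
    have hD : realDiagonal (constOn R (b - a)) =
        realDiagonal (constOn R b) - realDiagonal (constOn R a) := by
      unfold realDiagonal
      rw [Matrix.diagonal_sub]
      congr 1
      ext j
      unfold constOn
      split_ifs <;> simp
    rw [hD, Matrix.mul_sub, Matrix.sub_mul]
    abel
  have hPSD : ∀ Z : Fin N → ι → ℂ,
      (Matrix.of Z * realDiagonal (constOn R (b - a)) * (Matrix.of Z)ᴴ).PosSemidef := fun Z =>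
    (posSemidef_realDiagonal (constOn_nonneg R (sub_nonneg.2 hab.le))).mul_mul_conjTranspose_same _
  have hle : ∀ Z : Fin N → ι → ℂ,
      Real.log (1 + Matrix.of Z * realDiagonal (constOn R a) * (Matrix.of Z)ᴴ).det.re ≤
        Real.log (1 + Matrix.of Z * realDiagonal (constOn R b) * (Matrix.of Z)ᴴ).det.re := fun Z =>
    log_det_le_of_posSemidef_sub (hPD a ha Z) (hPD b hb Z) (by rw [hsub]; exact hPSD Z)
  have hia := integrable_rate_realDiagonal (N := N) (constOn_nonneg R ha)
  have hib := integrable_rate_realDiagonal (N := N) (constOn_nonneg R hb)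
  refine lt_of_le_of_ne (integral_mono hia hib hle) fun hint => ?_
  have hae := (integral_eq_iff_of_ae_le hia hib (Filter.Eventually.of_forall hle)).1 hint
  have hnull : stdMatrixLaw N ι ((fun Z : Fin N → ι → ℂ => Z ⟨0, hN⟩ j₀) ⁻¹' {0}) = 0 := by
    rw [(measurePreserving_entry _ _).measure_preimage
      (measurableSet_singleton _).nullMeasurableSet, complexGaussian_one_singleton_zero]
  obtain ⟨Z, hZeq, hZ⟩ := (hae.and (measure_eq_zero_iff_ae_notMem.1 hnull)).exists
  refine hZeq.not_lt ?_
  refine log_det_lt_of_posSemidef_sub (hPD a ha Z) (hPD b hb Z) (by rw [hsub]; exact hPSD Z) ?_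
  intro heq
  have h0 : (Matrix.of Z * realDiagonal (constOn R (b - a)) * (Matrix.of Z)ᴴ).trace.re = 0 := by
    rw [← hsub, heq, sub_self, Matrix.trace_zero, Complex.zero_re]
  rw [trace_mul_realDiagonal_mul] at h0
  have hnn : ∀ i j, 0 ≤ constOn R (b - a) j * Complex.normSq (Z i j) := fun i j =>
    mul_nonneg (constOn_nonneg R (sub_nonneg.2 hab.le) j) (Complex.normSq_nonneg _)
  have h1 := (Finset.sum_eq_zero_iff_of_nonneg fun i _ => Finset.sum_nonneg fun j _ => hnn i j).1 h0
    ⟨0, hN⟩ (Finset.mem_univ _)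
  have h2 := (Finset.sum_eq_zero_iff_of_nonneg fun j _ => hnn _ j).1 h1 j₀ (Finset.mem_univ _)
  rw [constOn, if_pos hj₀] at h2
  rcases mul_eq_zero.1 h2 with h3 | h3
  · exact (sub_pos.2 hab).ne' h3
  · exact hZ (Complex.normSq_eq_zero.1 h3)

end MeanRate

/-! ### Reduction of the throughput to the captured energy -/

section UniformFading

variable {N K M : ℕ} {d P₀ N₀ γ' : ℝ}

theorem fadingMatrix_const (d : ℝ) :
    fadingMatrix (fun _ : Fin K => d) = (d : ℂ) • (1 : Matrix (Fin K) (Fin K) ℂ) :=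
  (Matrix.smul_one_eq_diagonal _).symm

theorem dataCovariance_const (P₀ γ' : ℝ) :
    dataCovariance P₀ (fun _ : Fin K => γ') =
      ((γ' * P₀ : ℝ) : ℂ) • (1 : Matrix (Fin K) (Fin K) ℂ) :=
  (Matrix.smul_one_eq_diagonal _).symm

theorem pilotCovariance_const (N₀ d : ℝ) (X : Matrix (Fin K) (Fin M) ℂ) :
    pilotCovariance N₀ (fun _ => d) X =
      ((d ^ 2 : ℝ) : ℂ) • (Xᴴ * X) + (N₀ : ℂ) • (1 : Matrix (Fin M) (Fin M) ℂ) := by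
  rw [pilotCovariance, fadingMatrix_const, smul_pow, one_pow, Matrix.mul_smul, Matrix.mul_one,
    Matrix.smul_mul, Complex.ofReal_pow]

theorem posDef_smul_add_smul_one {n : Type*} [DecidableEq n] {A : Matrix n n ℂ}
    (hA : A.PosSemidef) {a b : ℝ} (ha : 0 ≤ a) (hb : 0 < b) :
    ((a : ℂ) • A + (b : ℂ) • (1 : Matrix n n ℂ)).PosDef :=
  Matrix.PosDef.posSemidef_add (hA.smul (by simpa using ha)) (Matrix.PosDef.one.smul (by simpa using hb))

theorem posDef_pilotCovariance (hN₀ : 0 < N₀) (X : Matrix (Fin K) (Fin M) ℂ) :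
    (pilotCovariance N₀ (fun _ => d) X).PosDef := by
  rw [pilotCovariance_const]
  exact posDef_smul_add_smul_one (Matrix.posSemidef_conjTranspose_mul_self X) (sq_nonneg d) hN₀

theorem isUnit_det {n : Type*} [Fintype n] [DecidableEq n] {A : Matrix n n ℂ} (hA : A.PosDef) :
    IsUnit A.det :=
  (Matrix.isUnit_iff_isUnit_det A).1 hA.isUnit

/-- The covariance `d² X_p (d² X_p† X_p + N₀ I)⁻¹ X_p†` of the rows of the channel estimate. -/
noncomputable def estimateCovariance (N₀ d : ℝ) (X : Matrix (Fin K) (Fin M) ℂ) :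
    Matrix (Fin K) (Fin K) ℂ :=
  ((d ^ 2 : ℝ) : ℂ) • (X * (pilotCovariance N₀ (fun _ => d) X)⁻¹ * Xᴴ)

/-- The matrix that maps a row of normalized fading and noise variables to a row of the channel
estimate. -/
noncomputable def estimationMatrix (N₀ d : ℝ) (X : Matrix (Fin K) (Fin M) ℂ) :
    Matrix (Fin K ⊕ Fin M) (Fin K) ℂ :=
  (d : ℂ) • (Matrix.fromRows ((d : ℂ) • X) ((Real.sqrt N₀ : ℂ) • (1 : Matrix (Fin M) (Fin M) ℂ)) *
    (pilotCovariance N₀ (fun _ => d) X)⁻¹ * Xᴴ)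

/-- The stacked factor F satisfies F†F = C, the pilot covariance, so one of the two inverses of C
cancels. -/
theorem conjTranspose_mul_estimationMatrix (hN₀ : 0 < N₀) (X : Matrix (Fin K) (Fin M) ℂ) :
    (estimationMatrix N₀ d X)ᴴ * estimationMatrix N₀ d X = estimateCovariance N₀ d X := by
  set C := pilotCovariance N₀ (fun _ => d) X with hC
  have hCP : C.PosDef := posDef_pilotCovariance hN₀ X
  have hCi : (C⁻¹)ᴴ = C⁻¹ := hCP.inv.1.eq
  set F := Matrix.fromRows ((d : ℂ) • X) ((Real.sqrt N₀ : ℂ) • (1 : Matrix (Fin M) (Fin M) ℂ)) with hF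
  have hFF : Fᴴ * F = C := by
    rw [hF, Matrix.conjTranspose_fromRows_eq_fromCols_conjTranspose, Matrix.fromCols_mul_fromRows, hC,
      pilotCovariance_const]
    simp only [Matrix.conjTranspose_smul, Complex.star_def, Complex.conj_ofReal, Matrix.smul_mul,
      Matrix.mul_smul, smul_smul, Matrix.conjTranspose_one, Matrix.one_mul]
    rw [← Complex.ofReal_mul, ← Complex.ofReal_mul, Real.mul_self_sqrt hN₀.le, ← sq]
  have hmid : C⁻¹ * (Fᴴ * F) * C⁻¹ = C⁻¹ := by
    rw [hFF, Matrix.nonsing_inv_mul _ (isUnit_det hCP), Matrix.one_mul]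
  have hL : estimationMatrix N₀ d X = (d : ℂ) • (F * C⁻¹ * Xᴴ) := rfl
  have hS : estimateCovariance N₀ d X = ((d ^ 2 : ℝ) : ℂ) • (X * C⁻¹ * Xᴴ) := rfl
  rw [hL, hS]
  simp only [Matrix.conjTranspose_smul, Complex.star_def, Complex.conj_ofReal, Matrix.smul_mul,
      Matrix.mul_smul, smul_smul, Matrix.conjTranspose_mul, Matrix.conjTranspose_conjTranspose, hCi]
  rw [← Complex.ofReal_mul, ← sq]
  congr 1
  calc X * (C⁻¹ * Fᴴ) * (F * C⁻¹ * Xᴴ) = X * (C⁻¹ * (Fᴴ * F) * C⁻¹) * Xᴴ := by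
        simp only [Matrix.mul_assoc]
    _ = _ := by rw [hmid]

/-- The average energy captured by the channel estimate. -/
noncomputable def estimateEnergy (N₀ d : ℝ) (X : Matrix (Fin K) (Fin M) ℂ) : ℝ :=
  (estimateCovariance N₀ d X).trace.re

theorem trace_estimationMatrix (hN₀ : 0 < N₀) (X : Matrix (Fin K) (Fin M) ℂ) :
    (estimationMatrix N₀ d X * (estimationMatrix N₀ d X)ᴴ).trace.re = estimateEnergy N₀ d X := by
  rw [Matrix.trace_mul_comm, conjTranspose_mul_estimationMatrix hN₀, estimateEnergy]

theorem estimateEnergy_nonneg (hN₀ : 0 < N₀) (X : Matrix (Fin K) (Fin M) ℂ) :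
    0 ≤ estimateEnergy N₀ d X := by
  rw [← trace_estimationMatrix hN₀]
  exact (Complex.nonneg_iff.1 (Matrix.posSemidef_self_mul_conjTranspose _).trace_nonneg).1

theorem noisePower_const (P₀ N₀ d γ' : ℝ) (X : Matrix (Fin K) (Fin M) ℂ) :
    noisePower P₀ N₀ (fun _ => d) (fun _ => γ') X =
      d ^ 2 * (γ' * P₀) * (K - estimateEnergy N₀ d X) + N₀ := by
  have hm : mmseMatrix N₀ (fun _ => d) X = 1 - estimateCovariance N₀ d X := by
    simp only [mmseMatrix, fadingMatrix_const, estimateCovariance, Matrix.smul_mul, Matrix.mul_smul,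
      Matrix.one_mul, Matrix.mul_one, smul_smul]
    rw [← Complex.ofReal_mul, ← sq]
  rw [noisePower, hm, fadingMatrix_const, dataCovariance_const, smul_pow, one_pow, Matrix.mul_smul,
    Matrix.mul_one, Matrix.mul_smul, Matrix.mul_one, smul_smul, ← Complex.ofReal_pow,
    ← Complex.ofReal_mul, Matrix.trace_smul, smul_eq_mul, Complex.re_ofReal_mul, Matrix.trace_sub,
    Complex.sub_re, Matrix.trace_one, Fintype.card_fin, Complex.natCast_re, estimateEnergy]
  ring

/-- The push-through identity X C⁻¹ = B⁻¹ X, a consequence of B X = X C, trades the inverse of size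
M for one of size K. This form serves the case K ≤ M. -/
theorem estimateCovariance_eq (hN₀ : 0 < N₀) (X : Matrix (Fin K) (Fin M) ℂ) :
    estimateCovariance N₀ d X = 1 - (N₀ : ℂ) •
      (((d ^ 2 : ℝ) : ℂ) • (X * Xᴴ) + (N₀ : ℂ) • (1 : Matrix (Fin K) (Fin K) ℂ))⁻¹ := by
  set B := ((d ^ 2 : ℝ) : ℂ) • (X * Xᴴ) + (N₀ : ℂ) • (1 : Matrix (Fin K) (Fin K) ℂ) with hB
  set C := pilotCovariance N₀ (fun _ => d) X with hC
  have hBu := isUnit_det (posDef_smul_add_smul_one (Matrix.posSemidef_self_mul_conjTranspose X)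
    (sq_nonneg d) hN₀)
  have hCu := isUnit_det (posDef_pilotCovariance (d := d) hN₀ X)
  rw [← hB] at hBu
  rw [← hC] at hCu
  have hcomm : B * X = X * C := by
    rw [hB, hC, pilotCovariance_const, Matrix.add_mul, Matrix.mul_add]
    simp only [Matrix.smul_mul, Matrix.mul_smul, Matrix.one_mul, Matrix.mul_one, Matrix.mul_assoc]
  have hpush : X * C⁻¹ = B⁻¹ * X := by
    calc X * C⁻¹ = B⁻¹ * (B * X) * C⁻¹ := by
          rw [← Matrix.mul_assoc, Matrix.nonsing_inv_mul _ hBu, Matrix.one_mul]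
      _ = B⁻¹ * X * (C * C⁻¹) := by rw [hcomm]; simp only [Matrix.mul_assoc]
      _ = B⁻¹ * X := by rw [Matrix.mul_nonsing_inv _ hCu, Matrix.mul_one]
  have hXX : ((d ^ 2 : ℝ) : ℂ) • (X * Xᴴ) = B - (N₀ : ℂ) • 1 := by
    rw [hB, add_sub_cancel_right]
  rw [estimateCovariance, ← hC, hpush, Matrix.mul_assoc, ← Matrix.mul_smul, hXX, Matrix.mul_sub,
    Matrix.nonsing_inv_mul _ hBu, Matrix.mul_smul, Matrix.mul_one]

theorem estimateEnergy_eq_of_rows (hN₀ : 0 < N₀) (X : Matrix (Fin K) (Fin M) ℂ) :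
    estimateEnergy N₀ d X = K - N₀ *
      (((d ^ 2 : ℝ) : ℂ) • (X * Xᴴ) + (N₀ : ℂ) • (1 : Matrix (Fin K) (Fin K) ℂ))⁻¹.trace.re := by
  rw [estimateEnergy, estimateCovariance_eq hN₀, Matrix.trace_sub, Matrix.trace_one,
    Fintype.card_fin, Matrix.trace_smul, smul_eq_mul, Complex.sub_re, Complex.re_ofReal_mul,
    Complex.natCast_re]

theorem estimateEnergy_eq_of_columns (hN₀ : 0 < N₀) (X : Matrix (Fin K) (Fin M) ℂ) :
    estimateEnergy N₀ d X = M - N₀ * (pilotCovariance N₀ (fun _ => d) X)⁻¹.trace.re := by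
  set C := pilotCovariance N₀ (fun _ => d) X with hC
  have hCu := isUnit_det (posDef_pilotCovariance (d := d) hN₀ X)
  rw [← hC] at hCu
  have hXX : ((d ^ 2 : ℝ) : ℂ) • (Xᴴ * X) = C - (N₀ : ℂ) • 1 := by
    rw [hC, pilotCovariance_const, add_sub_cancel_right]
  rw [estimateEnergy, estimateCovariance, ← hC, Matrix.trace_smul, Matrix.trace_mul_comm,
    ← Matrix.mul_assoc, ← Matrix.trace_smul, ← Matrix.smul_mul, hXX, Matrix.sub_mul,
    Matrix.mul_nonsing_inv _ hCu, Matrix.smul_mul, Matrix.one_mul, Matrix.trace_sub,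
    Matrix.trace_one, Fintype.card_fin, Matrix.trace_smul, smul_eq_mul, Complex.sub_re,
    Complex.re_ofReal_mul, Complex.natCast_re]

theorem estimateEnergy_le (hN₀ : 0 < N₀) (X : Matrix (Fin K) (Fin M) ℂ) :
    estimateEnergy N₀ d X ≤ K := by
  rw [estimateEnergy_eq_of_rows hN₀]
  have h := (posDef_smul_add_smul_one (Matrix.posSemidef_self_mul_conjTranspose X)
    (sq_nonneg d) hN₀).inv.posSemidef.trace_nonneg
  have := mul_nonneg hN₀.le (Complex.nonneg_iff.1 h).1
  linarith

theorem channelEstimate_const (X : Matrix (Fin K) (Fin M) ℂ)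
    (Z : Fin N → (Fin K ⊕ Fin M) → ℂ) :
    channelEstimate N₀ (fun _ => d) X (receivedPilots (fun _ => d) X
      (Matrix.of fun i k => Z i (Sum.inl k))
      (Matrix.of fun i m => (Real.sqrt N₀ : ℂ) * Z i (Sum.inr m))) =
      Matrix.of Z * estimationMatrix N₀ d X := by
  have hZ : Matrix.of Z = Matrix.fromCols (Matrix.of fun i k => Z i (Sum.inl k))
      (Matrix.of fun i m => Z i (Sum.inr m)) := by
    ext i (k | m) <;> rfl
  have hW : (Matrix.of fun i m => (Real.sqrt N₀ : ℂ) * Z i (Sum.inr m)) =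
      (Real.sqrt N₀ : ℂ) • Matrix.of fun i m => Z i (Sum.inr m) := rfl
  rw [hW, hZ, channelEstimate, receivedPilots, estimationMatrix, fadingMatrix_const]
  simp only [Matrix.mul_smul, Matrix.mul_one]
  rw [← Matrix.mul_assoc, ← Matrix.mul_assoc, Matrix.fromCols_mul_fromRows]
  simp only [Matrix.mul_smul, Matrix.smul_mul, Matrix.mul_one]

/-- The matrix `Q` such that the instantaneous rate is `log₂ det(1 + Z Q Z†)` for the normalized
fading and noise variables `Z`. -/
noncomputable def rateMatrix (P₀ N₀ d γ' : ℝ) (X : Matrix (Fin K) (Fin M) ℂ) :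
    Matrix (Fin K ⊕ Fin M) (Fin K ⊕ Fin M) ℂ :=
  ((d ^ 2 * (γ' * P₀) / noisePower P₀ N₀ (fun _ => d) (fun _ => γ') X : ℝ) : ℂ) •
    (estimationMatrix N₀ d X * (estimationMatrix N₀ d X)ᴴ)

theorem instantRate_const (X : Matrix (Fin K) (Fin M) ℂ)
    (Z : Fin N → (Fin K ⊕ Fin M) → ℂ) :
    instantRate P₀ N₀ (fun _ => d) (fun _ => γ') X (Matrix.of fun i k => Z i (Sum.inl k))
      (Matrix.of fun i m => (Real.sqrt N₀ : ℂ) * Z i (Sum.inr m)) =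
      Real.log (1 + Matrix.of Z * rateMatrix P₀ N₀ d γ' X * (Matrix.of Z)ᴴ).det.re / Real.log 2 := by
  simp only [instantRate, channelEstimate_const, fadingMatrix_const, dataCovariance_const,
    Real.logb, rateMatrix, Matrix.mul_smul, Matrix.smul_mul, Matrix.mul_one, smul_smul,
    Matrix.conjTranspose_mul, Matrix.mul_assoc]
  congr 6
  push_cast
  ring

theorem noisePower_pos (hN₀ : 0 < N₀) (hP₀ : 0 < P₀) (hγ' : 0 < γ')
    (X : Matrix (Fin K) (Fin M) ℂ) : 0 < noisePower P₀ N₀ (fun _ => d) (fun _ => γ') X := by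
  rw [noisePower_const]
  have h := estimateEnergy_le (d := d) hN₀ X
  have := mul_nonneg (by positivity : 0 ≤ d ^ 2 * (γ' * P₀)) (sub_nonneg.2 h)
  linarith

theorem posSemidef_rateMatrix (hN₀ : 0 < N₀) (hP₀ : 0 < P₀) (hγ' : 0 < γ')
    (X : Matrix (Fin K) (Fin M) ℂ) : (rateMatrix P₀ N₀ d γ' X).PosSemidef := by
  have h := noisePower_pos (d := d) hN₀ hP₀ hγ' X
  refine (Matrix.posSemidef_self_mul_conjTranspose _).smul ?_
  rw [Complex.zero_le_real]
  positivity

theorem measurable_instantRate (X : Matrix (Fin K) (Fin M) ℂ) :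
    Measurable fun p : (Fin N → Fin K → ℂ) × (Fin N → Fin M → ℂ) =>
      instantRate P₀ N₀ (fun _ => d) (fun _ => γ') X (Matrix.of p.1) (Matrix.of p.2) := by
  have h1 : Continuous fun p : (Fin N → Fin K → ℂ) × (Fin N → Fin M → ℂ) => Matrix.of p.1 :=
    continuous_fst
  have h2 : Continuous fun p : (Fin N → Fin K → ℂ) × (Fin N → Fin M → ℂ) => Matrix.of p.2 :=
    continuous_snd
  have hE : Continuous fun p : (Fin N → Fin K → ℂ) × (Fin N → Fin M → ℂ) =>
      channelEstimate N₀ (fun _ => d) X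
        (receivedPilots (fun _ => d) X (Matrix.of p.1) (Matrix.of p.2)) := by
    unfold channelEstimate receivedPilots
    fun_prop
  unfold instantRate Real.logb
  refine (measurable_log_det_re (continuous_const.add (Continuous.fun_const_smul ?_ _))).div_const _
  exact (((hE.matrix_mul continuous_const).matrix_mul continuous_const).matrix_mul
    continuous_const).matrix_mul hE.matrix_conjTranspose

theorem integrable_instantRate (hN₀ : 0 < N₀) (hP₀ : 0 < P₀) (hγ' : 0 < γ')
    (X : Matrix (Fin K) (Fin M) ℂ) :
    Integrable (fun p : (Fin N → Fin K → ℂ) × (Fin N → Fin M → ℂ) =>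
      instantRate P₀ N₀ (fun _ => d) (fun _ => γ') X (Matrix.of p.1) (Matrix.of p.2))
      (channelLaw N K M N₀) := by
  rw [← (measurePreserving_channel hN₀).integrable_comp
    (measurable_instantRate X).aestronglyMeasurable]
  exact ((integrable_rate (posSemidef_rateMatrix hN₀ hP₀ hγ' X)).div_const (Real.log 2)).congr
    (Filter.Eventually.of_forall fun Z => (instantRate_const X Z).symm)

theorem throughput_eq (hN₀ : 0 < N₀) (α : ℝ) (X : Matrix (Fin K) (Fin M) ℂ) :
    throughput N α P₀ N₀ (fun _ => d) (fun _ => γ') X =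
      (1 - α) * (meanRate N (rateMatrix P₀ N₀ d γ' X) / Real.log 2) := by
  have h := measurePreserving_channel (N := N) (K := K) (M := M) hN₀
  rw [throughput, ← h.map_eq, integral_map h.measurable.aemeasurable
    (measurable_instantRate X).aestronglyMeasurable, meanRate, ← integral_div]
  congr 1
  exact integral_congr_ae (Filter.Eventually.of_forall fun Z => instantRate_const X Z)

/-- The estimation matrix has K columns, and its last factor X† has M rows. -/
theorem rank_rateMatrix_le (X : Matrix (Fin K) (Fin M) ℂ) :
    (rateMatrix P₀ N₀ d γ' X).rank ≤ min K M := by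
  rw [rateMatrix, ← Matrix.mul_smul]
  refine (Matrix.rank_mul_le_left _ _).trans 
    (le_min ((Matrix.rank_le_card_width _).trans_eq (Fintype.card_fin _)) ?_)
  rw [estimationMatrix, ← Matrix.smul_mul]
  exact (Matrix.rank_mul_le_right _ _).trans (Matrix.rank_le_height _)

/-- The signal-to-noise ratio per unit of energy captured in each of `r` directions. -/
noncomputable def effectiveSNR (K r : ℕ) (c N₀ τ : ℝ) : ℝ :=
  c / (c * (K - τ) + N₀) * τ / r

/-- Captured energy enters twice, as signal in the numerator and as removed noise in the
denominator. The bound τ₂ ≤ K keeps the denominators positive. -/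
theorem effectiveSNR_lt {r : ℕ} {c τ₁ τ₂ : ℝ} (hr : 0 < r) (hc : 0 < c) (hN₀ : 0 < N₀)
    (h0 : 0 ≤ τ₁) (h12 : τ₁ < τ₂) (h2 : τ₂ ≤ K) :
    effectiveSNR K r c N₀ τ₁ < effectiveSNR K r c N₀ τ₂ := by
  have h3 : 0 < c * (K - τ₂) + N₀ := by
    have := mul_nonneg hc.le (sub_nonneg.2 h2)
    linarith
  have h4 : c * (K - τ₂) + N₀ ≤ c * (K - τ₁) + N₀ := by gcongr
  have hr' : (0 : ℝ) < r := by exact_mod_cast hr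
  unfold effectiveSNR
  refine div_lt_div_of_pos_right ?_ hr'
  exact mul_lt_mul' (div_le_div_of_nonneg_left hc.le h3 h4) h12 h0 (div_pos hc h3)

theorem trace_rateMatrix (hN₀ : 0 < N₀) (X : Matrix (Fin K) (Fin M) ℂ) (r : ℕ) :
    (rateMatrix P₀ N₀ d γ' X).trace.re / r =
      effectiveSNR K r (d ^ 2 * (γ' * P₀)) N₀ (estimateEnergy N₀ d X) := by
  rw [rateMatrix, Matrix.trace_smul, smul_eq_mul, Complex.re_ofReal_mul, trace_estimationMatrix hN₀,
    noisePower_const, effectiveSNR]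

theorem meanRate_rateMatrix_le (hN₀ : 0 < N₀) (hP₀ : 0 < P₀) (hγ' : 0 < γ')
    {R : Finset (Fin K ⊕ Fin M)} (hR : R.card = min K M) (hR0 : R.Nonempty)
    (X : Matrix (Fin K) (Fin M) ℂ) :
    meanRate N (rateMatrix P₀ N₀ d γ' X) ≤ meanRate N (realDiagonal (constOn R
      (effectiveSNR K R.card (d ^ 2 * (γ' * P₀)) N₀ (estimateEnergy N₀ d X)))) := by
  rw [← trace_rateMatrix hN₀]
  exact meanRate_le_of_rank_le (posSemidef_rateMatrix hN₀ hP₀ hγ' X) hR0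
    (hR ▸ rank_rateMatrix_le X)

/-- Since L ends in the factor X†, the eigenvector relation `hs` gives L L†L = sL. Hence Q² = ρsQ,
and Q is a multiple of a projection, so the upper bound is attained. -/
theorem meanRate_rateMatrix_eq (hN₀ : 0 < N₀) (hP₀ : 0 < P₀) (hγ' : 0 < γ')
    {R : Finset (Fin K ⊕ Fin M)} (hR0 : R.Nonempty)
    {X : Matrix (Fin K) (Fin M) ℂ} {s : ℝ} (hs : Xᴴ * estimateCovariance N₀ d X = (s : ℂ) • Xᴴ)
    (hτ : estimateEnergy N₀ d X = R.card * s) :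
    meanRate N (rateMatrix P₀ N₀ d γ' X) = meanRate N (realDiagonal (constOn R
      (effectiveSNR K R.card (d ^ 2 * (γ' * P₀)) N₀ (estimateEnergy N₀ d X)))) := by
  have hr : (R.card : ℝ) ≠ 0 := by exact_mod_cast hR0.card_pos.ne'
  rw [← trace_rateMatrix hN₀]
  set ρ : ℝ := d ^ 2 * (γ' * P₀) / noisePower P₀ N₀ (fun _ => d) (fun _ => γ') X with hρ
  set L := estimationMatrix N₀ d X with hL
  have hQ : rateMatrix P₀ N₀ d γ' X = (ρ : ℂ) • (L * Lᴴ) := rfl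
  have hLS : L * (Lᴴ * L) = (s : ℂ) • L := by
    rw [hL, conjTranspose_mul_estimationMatrix hN₀, estimationMatrix, Matrix.smul_mul,
      Matrix.mul_assoc, hs, Matrix.mul_smul, smul_comm]
  have htr : (rateMatrix P₀ N₀ d γ' X).trace.re = ρ * (R.card * s) := by
    rw [hQ, Matrix.trace_smul, smul_eq_mul, Complex.re_ofReal_mul, trace_estimationMatrix hN₀, hτ]
  have hs' : (rateMatrix P₀ N₀ d γ' X).trace.re / R.card = ρ * s := by
    rw [htr]
    field_simp
  rw [hs']
  refine meanRate_eq_of_mul_self_eq (posSemidef_rateMatrix hN₀ hP₀ hγ' X).1 ?_ (by rw [htr]; ring)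
  calc rateMatrix P₀ N₀ d γ' X * rateMatrix P₀ N₀ d γ' X
      = ((ρ : ℂ) * ρ) • (L * (Lᴴ * L) * Lᴴ) := by
        rw [hQ]
        simp only [Matrix.smul_mul, Matrix.mul_smul, smul_smul, Matrix.mul_assoc]
    _ = ((ρ * s : ℝ) : ℂ) • rateMatrix P₀ N₀ d γ' X := by
        rw [hLS, hQ, Matrix.smul_mul, smul_smul, smul_smul]
        congr 1
        push_cast
        ring

end UniformFading

/-! ### Maximizing the captured energy under the power constraint -/

section OptimalPilots

variable {N K M T : ℕ} {α d P₀ N₀ γ γ' : ℝ}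

theorem mem_feasiblePilots_iff {X : Matrix (Fin K) (Fin M) ℂ} :
    X ∈ feasiblePilots M α P₀ T (fun _ => γ) ↔
      ∀ k, (X * Xᴴ) k k = ((α * γ * P₀ * T : ℝ) : ℂ) := by
  rw [feasiblePilots, Set.mem_ofPred_eq, trainingEnergy, Matrix.diagonal_eq_diagonal_iff]
  rfl

theorem mul_conjTranspose_self_apply (X : Matrix (Fin K) (Fin M) ℂ) (k : Fin K) :
    (X * Xᴴ) k k = ((‖WithLp.toLp 2 (X k)‖ ^ 2 : ℝ) : ℂ) := by
  rw [EuclideanSpace.norm_sq_eq, Matrix.mul_apply, Complex.ofReal_sum]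
  refine Finset.sum_congr rfl fun m _ => ?_
  rw [Matrix.conjTranspose_apply, Complex.star_def, Complex.mul_conj, Complex.normSq_eq_norm_sq]

theorem mem_feasiblePilots_iff_norm {X : Matrix (Fin K) (Fin M) ℂ} :
    X ∈ feasiblePilots M α P₀ T (fun _ => γ) ↔
      ∀ k, ‖WithLp.toLp 2 (X k)‖ ^ 2 = α * γ * P₀ * T := by
  rw [mem_feasiblePilots_iff]
  refine forall_congr' fun k => ?_
  rw [mul_conjTranspose_self_apply, Complex.ofReal_inj]

theorem trace_mul_conjTranspose_of_mem {X : Matrix (Fin K) (Fin M) ℂ}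
    (hX : X ∈ feasiblePilots M α P₀ T fun _ => γ) :
    (X * Xᴴ).trace.re = K * (α * γ * P₀ * T) := by
  simp only [Matrix.trace, Matrix.diag_apply, mem_feasiblePilots_iff.1 hX, Finset.sum_const,
    Finset.card_univ, Fintype.card_fin, nsmul_eq_mul]
  rw [← Complex.ofReal_natCast, ← Complex.ofReal_mul, Complex.ofReal_re]

/-- If the captured energy is bounded on the feasible set, and the bound is attained with equal
energy in `min K M` directions exactly on `P`, then `P` describes the optimal pilots. -/
theorem isOptimalPilot_iff_of_estimateEnergy (hN : 0 < N) (hα : α < 1) (hd : 0 < d) (hP₀ : 0 < P₀)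
    (hN₀ : 0 < N₀) (hγ' : 0 < γ') (hKM : 0 < min K M) {s : ℝ}
    {P : Matrix (Fin K) (Fin M) ℂ → Prop}
    (hle : ∀ X ∈ feasiblePilots M α P₀ T fun _ => γ, estimateEnergy N₀ d X ≤ (min K M : ℕ) * s ∧
      (estimateEnergy N₀ d X = (min K M : ℕ) * s → P X))
    (hP : ∀ X, P X → Xᴴ * estimateCovariance N₀ d X = (s : ℂ) • Xᴴ ∧
      estimateEnergy N₀ d X = (min K M : ℕ) * s)
    (hex : ∃ X ∈ feasiblePilots M α P₀ T fun _ => γ, P X) (X : Matrix (Fin K) (Fin M) ℂ) :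
    IsOptimalPilot N T α P₀ N₀ (fun _ => d) (fun _ => γ) (fun _ => γ') X ↔
      X ∈ feasiblePilots M α P₀ T (fun _ => γ) ∧ P X := by
  obtain ⟨R, -, hR⟩ := Finset.exists_subset_card_eq
    (s := (Finset.univ : Finset (Fin K ⊕ Fin M))) (n := min K M) (by simp)
  have hR0 : R.Nonempty := Finset.card_pos.1 (by omega)
  set c := d ^ 2 * (γ' * P₀)
  have hc0 : 0 < c := by positivity
  -- The best throughput compatible with captured energy τ; the pilots enter only through τ.
  set G : ℝ → ℝ := fun τ =>
    (1 - α) * (meanRate N (realDiagonal (constOn R (effectiveSNR K R.card c N₀ τ))) / Real.log 2)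
  have hlog : 0 < Real.log 2 := Real.log_pos one_lt_two
  have hα' : 0 < 1 - α := sub_pos.2 hα
  have hup : ∀ X : Matrix (Fin K) (Fin M) ℂ,
      throughput N α P₀ N₀ (fun _ => d) (fun _ => γ') X ≤ G (estimateEnergy N₀ d X) := by
    intro X
    rw [throughput_eq hN₀]
    exact mul_le_mul_of_nonneg_left (div_le_div_of_nonneg_right
      (meanRate_rateMatrix_le hN₀ hP₀ hγ' hR hR0 X) hlog.le) hα'.le
  have hattain : ∀ X : Matrix (Fin K) (Fin M) ℂ, P X →
      throughput N α P₀ N₀ (fun _ => d) (fun _ => γ') X = G (estimateEnergy N₀ d X) := by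
    intro X hX
    obtain ⟨h1, h2⟩ := hP X hX
    rw [throughput_eq hN₀, meanRate_rateMatrix_eq hN₀ hP₀ hγ' hR0 h1 (by rw [hR, h2])]
  have hmono : ∀ τ₁ τ₂ : ℝ, 0 ≤ τ₁ → τ₁ < τ₂ → τ₂ ≤ K → G τ₁ < G τ₂ := by
    intro τ₁ τ₂ h0 h12 h2
    have h3 : 0 ≤ effectiveSNR K R.card c N₀ τ₁ := by
      have : 0 ≤ c * (K - τ₁) := mul_nonneg hc0.le (by linarith)
      unfold effectiveSNR
      positivity
    exact mul_lt_mul_of_pos_left (div_lt_div_of_pos_right (meanRate_constOn_strictMono hN hR0 h3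
      (effectiveSNR_lt hR0.card_pos hc0 hN₀ h0 h12 h2)) hlog) hα'
  obtain ⟨X₀, hX₀, hPX₀⟩ := hex
  have hτ₀ := (hP X₀ hPX₀).2
  constructor
  · rintro ⟨hX, hmax⟩
    refine ⟨hX, (hle X hX).2 ?_⟩
    -- Energy below the maximum gives a throughput of at most G(τ), strictly below that of X₀, which
    -- contradicts optimality.
    by_contra hne
    have hlt := lt_of_le_of_ne (hle X hX).1 hne
    rw [← hτ₀] at hlt
    have h1 := hmono _ _ (estimateEnergy_nonneg hN₀ X) hlt (estimateEnergy_le hN₀ X₀)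
    rw [← hattain X₀ hPX₀] at h1
    exact absurd (hmax hX₀) (not_le.2 ((hup X).trans_lt h1))
  · rintro ⟨hX, hPX⟩
    refine ⟨hX, fun X' hX' => ?_⟩
    change throughput N α P₀ N₀ (fun _ => d) (fun _ => γ') X' ≤ _
    refine (hup X').trans ?_
    rw [hattain X hPX, (hP X hPX).2, ← (hP X hPX).2]
    rcases ((hle X' hX').1.trans_eq (hP X hPX).2.symm).lt_or_eq with h | h
    · exact (hmono _ _ (estimateEnergy_nonneg hN₀ X') h (estimateEnergy_le hN₀ X)).le
    · rw [h]

theorem smul_one_inv {n : Type*} [Fintype n] [DecidableEq n] {c : ℝ} (hc : 0 < c) :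
    ((c : ℂ) • (1 : Matrix n n ℂ))⁻¹ = ((c⁻¹ : ℝ) : ℂ) • 1 := by
  refine Matrix.inv_eq_right_inv ?_
  rw [Matrix.smul_mul, Matrix.one_mul, smul_smul, ← Complex.ofReal_mul, mul_inv_cancel₀ hc.ne',
    Complex.ofReal_one, one_smul]

theorem smul_add_smul_one_eq_iff {n : Type*} [DecidableEq n] {A : Matrix n n ℂ} {a b e : ℝ}
    (ha : 0 < a) :
    (a : ℂ) • A + (b : ℂ) • (1 : Matrix n n ℂ) = ((a * e + b : ℝ) : ℂ) • (1 : Matrix n n ℂ) ↔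
      A = (e : ℂ) • (1 : Matrix n n ℂ) := by
  have ha' : (a : ℂ) ≠ 0 := Complex.ofReal_ne_zero.2 ha.ne'
  rw [Complex.ofReal_add, add_smul, add_left_inj, Complex.ofReal_mul, mul_smul]
  exact (smul_right_injective _ ha').eq_iff

/-- The sum of `A (A + b)⁻¹` over the spectrum of `A` is largest when `A` is scalar. -/
theorem card_sub_trace_inv_le {n : Type*} [Fintype n] [DecidableEq n] {A : Matrix n n ℂ}
    (hA : A.PosSemidef) {a b e : ℝ} (ha : 0 < a) (hb : 0 < b) (he : 0 ≤ e)
    (htr : A.trace.re = Fintype.card n * e) :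
    Fintype.card n - b * ((a : ℂ) • A + (b : ℂ) • (1 : Matrix n n ℂ))⁻¹.trace.re ≤
        Fintype.card n * (a * e / (a * e + b)) ∧
      (Fintype.card n - b * ((a : ℂ) • A + (b : ℂ) • (1 : Matrix n n ℂ))⁻¹.trace.re =
        Fintype.card n * (a * e / (a * e + b)) ↔ A = (e : ℂ) • (1 : Matrix n n ℂ)) := by
  have hc : 0 < a * e + b := by positivity
  -- The mean inequality is applied to aA + b, whose eigenvalues have mean ae + b.
  have h := card_sq_le_trace_mul_trace_inv (posDef_smul_add_smul_one hA ha.le hb) hc (by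
    rw [Matrix.trace_add, Matrix.trace_smul, Matrix.trace_smul, Matrix.trace_one, Complex.add_re,
      smul_eq_mul, smul_eq_mul, Complex.re_ofReal_mul, Complex.re_ofReal_mul, htr,
      Complex.natCast_re]
    ring)
  have key : (Fintype.card n : ℝ) * (a * e / (a * e + b)) =
      Fintype.card n - b * (Fintype.card n / (a * e + b)) := by
    field_simp
    ring
  rw [key]
  refine ⟨by gcongr; exact h.1, fun heq => ?_, fun hAe => ?_⟩
  · rw [← smul_add_smul_one_eq_iff ha]
    exact h.2 (mul_left_cancel₀ hb.ne' (sub_right_injective heq))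
  · rw [(smul_add_smul_one_eq_iff ha).2 hAe, smul_one_inv hc, Matrix.trace_smul, Matrix.trace_one,
      smul_eq_mul, Complex.re_ofReal_mul, Complex.natCast_re]
    ring

/-- The rows are √e times the first K standard basis vectors. -/
theorem exists_mul_conjTranspose_eq_smul_one (hKM : K ≤ M) {e : ℝ} (he : 0 ≤ e) :
    ∃ X : Matrix (Fin K) (Fin M) ℂ, X * Xᴴ = (e : ℂ) • (1 : Matrix (Fin K) (Fin K) ℂ) := by
  refine ⟨Matrix.of fun k m => if m = Fin.castLE hKM k then (Real.sqrt e : ℂ) else 0, ?_⟩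
  ext i j
  rw [Matrix.mul_apply, Finset.sum_eq_single (Fin.castLE hKM i)]
  · by_cases hij : i = j
    · subst hij
      simp [← Complex.ofReal_mul, Real.mul_self_sqrt he]
    · simp [hij]
  · intro m _ hm
    simp [hm]
  · simp

/-- The row Gram matrix is the one that can be scalar here. Its diagonal then already expresses the
power constraint, so feasibility drops out of the criterion. -/
theorem isOptimalPilot_iff_of_le (hN : 0 < N) (hα₀ : 0 < α) (hα : α < 1) (hd : 0 < d) (hP₀ : 0 < P₀)
    (hN₀ : 0 < N₀) (hγ : 0 ≤ γ) (hγ' : 0 < γ') (hK : 0 < K) (hKM : K ≤ M)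
    (X : Matrix (Fin K) (Fin M) ℂ) :
    IsOptimalPilot N T α P₀ N₀ (fun _ => d) (fun _ => γ) (fun _ => γ') X ↔
      X * Xᴴ = ((α * γ * P₀ * T : ℝ) : ℂ) • (1 : Matrix (Fin K) (Fin K) ℂ) := by
  set e : ℝ := α * γ * P₀ * T with he
  have he0 : 0 ≤ e := by positivity
  have hd2 : 0 < d ^ 2 := by positivity
  have hmin : min K M = K := min_eq_left hKM
  have hfeas : ∀ X : Matrix (Fin K) (Fin M) ℂ, X * Xᴴ = (e : ℂ) • (1 : Matrix (Fin K) (Fin K) ℂ) →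
      X ∈ feasiblePilots M α P₀ T (fun _ => γ) := by
    intro X hX
    rw [mem_feasiblePilots_iff, hX]
    simp [he]
  have hc : 0 < d ^ 2 * e + N₀ := by positivity
  have hbound : ∀ X : Matrix (Fin K) (Fin M) ℂ, (X * Xᴴ).trace.re = K * e →
      estimateEnergy N₀ d X ≤ K * (d ^ 2 * e / (d ^ 2 * e + N₀)) ∧
        (estimateEnergy N₀ d X = K * (d ^ 2 * e / (d ^ 2 * e + N₀)) ↔ X * Xᴴ = (e : ℂ) • 1) := by
    intro X hX
    rw [estimateEnergy_eq_of_rows hN₀]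
    have h := card_sub_trace_inv_le (Matrix.posSemidef_self_mul_conjTranspose X) hd2 hN₀ he0
      (by rw [hX, Fintype.card_fin])
    rwa [Fintype.card_fin] at h
  rw [isOptimalPilot_iff_of_estimateEnergy (s := d ^ 2 * e / (d ^ 2 * e + N₀))
    (P := fun X => X * Xᴴ = (e : ℂ) • 1) hN hα hd hP₀ hN₀ hγ' (by omega)]
  · exact ⟨fun h => h.2, fun h => ⟨hfeas X h, h⟩⟩
  · intro X hX
    rw [hmin]
    have h := hbound X (trace_mul_conjTranspose_of_mem hX)
    exact ⟨h.1, h.2.1⟩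
  · intro X hX
    rw [hmin]
    refine ⟨?_, (hbound X (trace_mul_conjTranspose_of_mem (hfeas X hX))).2.2 hX⟩
    rw [estimateCovariance_eq hN₀, (smul_add_smul_one_eq_iff hd2).2 hX, smul_one_inv hc, smul_smul,
      Matrix.mul_sub, Matrix.mul_one, Matrix.mul_smul, Matrix.mul_one, ← Complex.ofReal_mul]
    nth_rw 1 [← one_smul ℂ Xᴴ]
    rw [← sub_smul, ← Complex.ofReal_one, ← Complex.ofReal_sub]
    congr 2
    field_simp
    ring
  · obtain ⟨X, hX⟩ := exists_mul_conjTranspose_eq_smul_one hKM he0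
    exact ⟨X, hfeas X hX, hX⟩

/-- Rows of a scaled discrete Fourier matrix, truncated to its first `M ≤ K` columns. -/
theorem exists_equal_norm_rows_orthogonal_columns (hKM : M ≤ K) {p : ℝ} (hp : 0 ≤ p) :
    ∃ X : Matrix (Fin K) (Fin M) ℂ,
      Xᴴ * X = ((p * K : ℝ) : ℂ) • (1 : Matrix (Fin M) (Fin M) ℂ) ∧
        ∀ k, (X * Xᴴ) k k = ((M * p : ℝ) : ℂ) := by
  rcases Nat.eq_zero_or_pos K with rfl | hK
  · obtain rfl : M = 0 := by omega
    exact ⟨0, Subsingleton.elim _ _, fun k => k.elim0⟩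
  obtain ⟨ζ, hζ⟩ : ∃ ζ : ℂ, IsPrimitiveRoot ζ K := ⟨_, Complex.isPrimitiveRoot_exp K hK.ne'⟩
  have hnorm : ‖ζ‖ = 1 := hζ.norm'_eq_one hK.ne'
  have hstar : ∀ z : ℂ, ‖z‖ = 1 → z * star z = 1 := by
    intro z hz
    rw [Complex.star_def, Complex.mul_conj, Complex.normSq_eq_norm_sq, hz]
    simp
  have hpow : ∀ k m : ℕ, ‖ζ ^ (k * m)‖ = 1 := fun k m => by rw [norm_pow, hnorm, one_pow]
  have hsq : (Real.sqrt p : ℂ) * Real.sqrt p = p := by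
    rw [← Complex.ofReal_mul, Real.mul_self_sqrt hp]
  refine ⟨Matrix.of fun k m => (Real.sqrt p : ℂ) * ζ ^ ((k : ℕ) * (m : ℕ)), ?_, ?_⟩
  · ext m m'
    rw [Matrix.mul_apply]
    have hterm : ∀ k : Fin K, (star ((Real.sqrt p : ℂ) * ζ ^ ((k : ℕ) * (m : ℕ)))) *
        ((Real.sqrt p : ℂ) * ζ ^ ((k : ℕ) * (m' : ℕ))) =
        p * (star (ζ ^ (m : ℕ)) * ζ ^ (m' : ℕ)) ^ (k : ℕ) := by
      intro k
      rw [star_mul', Complex.star_def, Complex.conj_ofReal, mul_pow, ← hsq, map_pow, map_pow,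
        ← pow_mul, ← pow_mul, mul_comm (m : ℕ), mul_comm (m' : ℕ)]
      ring
    simp only [Matrix.conjTranspose_apply, Matrix.of_apply, hterm]
    rw [← Finset.mul_sum, Fin.sum_univ_eq_sum_range fun k => (star (ζ ^ (m : ℕ)) * ζ ^ (m' : ℕ)) ^ k]
    by_cases hmm : m = m'
    · subst hmm
      have h1 : star (ζ ^ (m : ℕ)) * ζ ^ (m : ℕ) = 1 := by
        rw [mul_comm]
        exact hstar _ (by rw [norm_pow, hnorm, one_pow])
      simp only [h1, one_pow, Finset.sum_const, Finset.card_range, nsmul_eq_mul, mul_one,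
        Matrix.smul_apply, Matrix.one_apply_eq, smul_eq_mul, Complex.ofReal_mul,
        Complex.ofReal_natCast]
    · set ω := star (ζ ^ (m : ℕ)) * ζ ^ (m' : ℕ) with hω
      have hωK : ω ^ K = 1 := by
        rw [hω, mul_pow, ← star_pow, ← pow_mul, ← pow_mul, mul_comm _ K, mul_comm _ K, pow_mul,
          pow_mul, hζ.pow_eq_one]
        simp
      -- Both column indices are below M ≤ K, so distinct ones give distinct powers of the primitive
      -- K-th root ζ. The geometric sum over all K rows then vanishes.
      have hω1 : ω ≠ 1 := by
        intro h
        have h2 : ζ ^ (m' : ℕ) = ζ ^ (m : ℕ) := by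
          calc ζ ^ (m' : ℕ) = (ζ ^ (m : ℕ) * star (ζ ^ (m : ℕ))) * ζ ^ (m' : ℕ) := by
                rw [hstar _ (by rw [norm_pow, hnorm, one_pow]), one_mul]
            _ = ζ ^ (m : ℕ) := by rw [mul_assoc, ← hω, h, mul_one]
        exact hmm (Fin.ext (hζ.pow_inj (m'.2.trans_le hKM) (m.2.trans_le hKM) h2).symm)
      have hsum : ∑ k ∈ Finset.range K, ω ^ k = 0 := by
        have h := geom_sum_mul ω K
        rw [hωK, sub_self] at h
        exact (mul_eq_zero.1 h).resolve_right (sub_ne_zero.2 hω1)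
      simp [hsum, hmm]
  · intro k
    rw [Matrix.mul_apply]
    have hterm : ∀ m : Fin M, ((Real.sqrt p : ℂ) * ζ ^ ((k : ℕ) * (m : ℕ))) *
        star ((Real.sqrt p : ℂ) * ζ ^ ((k : ℕ) * (m : ℕ))) = p := by
      intro m
      rw [star_mul', Complex.star_def, Complex.conj_ofReal, mul_mul_mul_comm, hsq,
        ← Complex.star_def, hstar _ (hpow _ _), mul_one]
    simp only [Matrix.conjTranspose_apply, Matrix.of_apply, hterm]
    simp

/-- The column Gram matrix takes over. Its scalar value γP₀K is the total energy KαγP₀T divided by M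
= αT. It does not determine the individual row norms, so feasibility remains a separate condition.
-/
theorem isOptimalPilot_iff_of_lt (hN : 0 < N) (hα : α < 1) (hd : 0 < d)
    (hP₀ : 0 < P₀) (hN₀ : 0 < N₀) (hγ : 0 ≤ γ) (hγ' : 0 < γ') (hM : (M : ℝ) = α * T) (hM0 : 0 < M)
    (hKM : M < K) (X : Matrix (Fin K) (Fin M) ℂ) :
    IsOptimalPilot N T α P₀ N₀ (fun _ => d) (fun _ => γ) (fun _ => γ') X ↔
      X ∈ feasiblePilots M α P₀ T (fun _ => γ) ∧
        Xᴴ * X = ((γ * P₀ * K : ℝ) : ℂ) • (1 : Matrix (Fin M) (Fin M) ℂ) := by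
  set f : ℝ := γ * P₀ * K with hf
  have hf0 : 0 ≤ f := by positivity
  have hd2 : 0 < d ^ 2 := by positivity
  have hmin : min K M = M := min_eq_right hKM.le
  have hc : 0 < d ^ 2 * f + N₀ := by positivity
  have he : α * γ * P₀ * T = M * (γ * P₀) := by
    rw [hM]
    ring
  have hbound : ∀ X : Matrix (Fin K) (Fin M) ℂ, (Xᴴ * X).trace.re = M * f →
      estimateEnergy N₀ d X ≤ M * (d ^ 2 * f / (d ^ 2 * f + N₀)) ∧
        (estimateEnergy N₀ d X = M * (d ^ 2 * f / (d ^ 2 * f + N₀)) ↔ Xᴴ * X = (f : ℂ) • 1) := by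
    intro X hX
    rw [estimateEnergy_eq_of_columns hN₀, pilotCovariance_const]
    have h := card_sub_trace_inv_le (Matrix.posSemidef_conjTranspose_mul_self X) hd2 hN₀ hf0
      (by rw [hX, Fintype.card_fin])
    rwa [Fintype.card_fin] at h
  rw [isOptimalPilot_iff_of_estimateEnergy (s := d ^ 2 * f / (d ^ 2 * f + N₀))
    (P := fun X => Xᴴ * X = (f : ℂ) • 1) hN hα hd hP₀ hN₀ hγ' (by omega)]
  · intro X hX
    rw [hmin]
    have h := hbound X (by
      rw [Matrix.trace_mul_comm, trace_mul_conjTranspose_of_mem hX, he, hf]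
      ring)
    exact ⟨h.1, h.2.1⟩
  · intro X hX
    rw [hmin]
    refine ⟨?_, (hbound X ?_).2.2 hX⟩
    · rw [estimateCovariance, pilotCovariance_const, (smul_add_smul_one_eq_iff hd2).2 hX,
        smul_one_inv hc, Matrix.mul_smul, Matrix.mul_smul X, Matrix.mul_one, Matrix.smul_mul,
        Matrix.mul_smul, ← Matrix.mul_assoc, hX, Matrix.smul_mul, Matrix.one_mul, smul_smul,
        smul_smul, ← Complex.ofReal_mul, ← Complex.ofReal_mul]
      congr 2
      field_simp
    · rw [hX]
      simp
      ring
  · obtain ⟨X, hX1, hX2⟩ := exists_equal_norm_rows_orthogonal_columns hKM.le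
      (mul_nonneg hγ hP₀.le)
    exact ⟨X, mem_feasiblePilots_iff.2 fun k => by rw [hX2, he], hX1⟩

/-- K nonzero orthogonal vectors do not fit into dimension M < K: the Gram matrix would have rank K.
-/
theorem exists_dotProduct_ne_zero (hKM : M < K) {e : ℝ} (he : 0 < e) {X : Matrix (Fin K) (Fin M) ℂ}
    (hX : ∀ k, (X * Xᴴ) k k = (e : ℂ)) : ∃ i j, i ≠ j ∧ X i ⬝ᵥ star (X j) ≠ 0 := by
  by_contra! h
  have hXX : X * Xᴴ = (e : ℂ) • (1 : Matrix (Fin K) (Fin K) ℂ) := by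
    ext i j
    by_cases hij : i = j
    · subst hij
      simp [hX]
    · rw [Matrix.smul_apply, Matrix.one_apply_ne hij, smul_zero]
      exact h i j hij
  have hunit : IsUnit (X * Xᴴ) := by
    rw [hXX, Matrix.isUnit_iff_isUnit_det, Matrix.det_smul]
    simp [he.ne']
  have h1 := Matrix.rank_of_isUnit _ hunit
  have h2 := (Matrix.rank_mul_le_left X Xᴴ).trans (Matrix.rank_le_width X)
  rw [h1, Fintype.card_fin] at h2
  omega

end OptimalPilots

end MIMO

/-! ### The theorem -/

theorem mainTheorem4 (N K T M : ℕ) (hN : 0 < N) (hT : 0 < T)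
    (α : ℝ) (hα₀ : 0 < α) (hα₁ : α < 1) (hM : (M : ℝ) = α * T)
    (P₀ N₀ : ℝ) (hP₀ : 0 < P₀) (hN₀ : 0 < N₀)
    (d γ γ' : ℝ) (hd : 0 < d) (hγ : 0 ≤ γ) (hγ' : 0 < γ') :
    -- the expectation that defines the throughput exists for every pilot matrix
    (∀ X : Matrix (Fin K) (Fin M) ℂ,
      Integrable
        (fun p : (Fin N → Fin K → ℂ) × (Fin N → Fin M → ℂ) =>
          MIMO.instantRate P₀ N₀ (fun _ => d) (fun _ => γ') X (Matrix.of p.1) (Matrix.of p.2))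
        (MIMO.channelLaw N K M N₀)) ∧
    -- an optimal pilot matrix exists
    (∃ X : Matrix (Fin K) (Fin M) ℂ,
      MIMO.IsOptimalPilot N T α P₀ N₀ (fun _ => d) (fun _ => γ) (fun _ => γ') X) ∧
    ((K : ℝ) ≤ α * T → ∀ X : Matrix (Fin K) (Fin M) ℂ,
      MIMO.IsOptimalPilot N T α P₀ N₀ (fun _ => d) (fun _ => γ) (fun _ => γ') X ↔
        X * Xᴴ = ((α * γ * P₀ * T : ℝ) : ℂ) • (1 : Matrix (Fin K) (Fin K) ℂ)) ∧
    (α * T < (K : ℝ) → ∀ X : Matrix (Fin K) (Fin M) ℂ,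
      (MIMO.IsOptimalPilot N T α P₀ N₀ (fun _ => d) (fun _ => γ) (fun _ => γ') X ↔
        Xᴴ * X = ((γ * P₀ * K : ℝ) : ℂ) • (1 : Matrix (Fin M) (Fin M) ℂ) ∧
          ∀ k, ‖WithLp.toLp 2 (X k)‖ ^ 2 = α * γ * P₀ * T) ∧
      -- the pilots of an optimal matrix are not mutually orthogonal
      (0 < γ → MIMO.IsOptimalPilot N T α P₀ N₀ (fun _ => d) (fun _ => γ) (fun _ => γ') X →
        ∃ i j, i ≠ j ∧ X i ⬝ᵥ star (X j) ≠ 0)) := by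
  have hM0 : 0 < M := by
    have h : (0 : ℝ) < M := by
      rw [hM]
      positivity
    exact_mod_cast h
  have hsmall : K ≤ M → ∀ X : Matrix (Fin K) (Fin M) ℂ,
      MIMO.IsOptimalPilot N T α P₀ N₀ (fun _ => d) (fun _ => γ) (fun _ => γ') X ↔
        X * Xᴴ = ((α * γ * P₀ * T : ℝ) : ℂ) • (1 : Matrix (Fin K) (Fin K) ℂ) := by
    intro hKM X
    -- Without users there is only one pilot matrix; the general criterion needs min K M > 0.
    rcases Nat.eq_zero_or_pos K with rfl | hK
    · refine iff_of_true ⟨?_, fun Y _ => ?_⟩ (Subsingleton.elim _ _)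
      · exact MIMO.mem_feasiblePilots_iff.2 fun k => k.elim0
      · rw [Subsingleton.elim Y X]
        exact (le_rfl : MIMO.throughput N α P₀ N₀ _ _ X ≤ MIMO.throughput N α P₀ N₀ _ _ X)
    · exact MIMO.isOptimalPilot_iff_of_le hN hα₀ hα₁ hd hP₀ hN₀ hγ hγ' hK hKM X
  have hlarge : M < K → ∀ X : Matrix (Fin K) (Fin M) ℂ,
      MIMO.IsOptimalPilot N T α P₀ N₀ (fun _ => d) (fun _ => γ) (fun _ => γ') X ↔
        X ∈ MIMO.feasiblePilots M α P₀ T (fun _ => γ) ∧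
          Xᴴ * X = ((γ * P₀ * K : ℝ) : ℂ) • (1 : Matrix (Fin M) (Fin M) ℂ) := fun hKM =>
    MIMO.isOptimalPilot_iff_of_lt hN hα₁ hd hP₀ hN₀ hγ hγ' hM hM0 hKM
  rw [← hM]
  simp only [Nat.cast_le, Nat.cast_lt]
  refine ⟨fun X => MIMO.integrable_instantRate hN₀ hP₀ hγ' X, ?_, hsmall, fun hKM X =>
    ⟨?_, fun hγ0 hX => ?_⟩⟩
  · rcases le_or_gt K M with hKM | hKM
    · obtain ⟨X, hX⟩ := MIMO.exists_mul_conjTranspose_eq_smul_one hKM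
        (by positivity : 0 ≤ α * γ * P₀ * T)
      exact ⟨X, (hsmall hKM X).2 hX⟩
    · obtain ⟨X, hX1, hX2⟩ := MIMO.exists_equal_norm_rows_orthogonal_columns hKM.le
        (mul_nonneg hγ hP₀.le)
      refine ⟨X, (hlarge hKM X).2 ⟨MIMO.mem_feasiblePilots_iff.2 fun k => ?_, hX1⟩⟩
      rw [hX2, hM]
      congr 1
      ring
  · rw [hlarge hKM X, MIMO.mem_feasiblePilots_iff_norm, and_comm]
  · exact MIMO.exists_dotProduct_ne_zero hKM (by positivity : 0 < α * γ * P₀ * T)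
      (MIMO.mem_feasiblePilots_iff.1 hX.1)
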